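/- Let $\Lambda$ be a lattice of finite rank $r$ and $V=\Lambda\otimes\mathbb R$. *Conventions.* A cycle in $V$ is a balanced, weighted (with integer weights), pure-dimensional, rational polyhedral fan, considered up to the equivalence of having a common refinement with agreeing weights (facets of weight $0$ being disregarded). Cones may contain linear subspaces. For a cone $\sigma$, $V_\sigma$ is its linear span and $\Lambda_\sigma=\Lambda\cap V_\sigma$; for a facet $\sigma$ and a ridge (codimension one cone) $\tau<\sigma$, $v_{\sigma/\tau}\in\Lambda$ is a primitive vector, i.e. it points from $\tau$ towards $\sigma$ and $\mathbb Z v_{\sigma/\tau}+\Lambda_\tau=\Lambda_\sigma$; balanced means $\sum_{\sigma>\tau}\omega(\sigma)v_{\sigma/\tau}\in V_\tau$ for every ridge $\tau$. If $\varphi$ is a function that is integer linear on each cone of a fan $X$, with linear extensions $\varphi_\sigma:V_\sigma\to\mathbb R$, then $\varphi\cdot X$ is the codimension one skeleton of $X$ with the weights $$\omega_{\varphi\cdot X}(\tau)=\sum_{\sigma>\tau}\omega(\sigma)\,\varphi_\sigma(v_{\sigma/\tau})-\varphi_\tau\Big(\sum_{\sigma>\tau}\omega(\sigma)\,v_{\sigma/\tau}\Big)$$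 on the ridges $\tau$ of $X$. The intersection product of two cycles $X,Y$ in $V$ is $$X\cdot Y:=\pi_*\big(\max\{x_1,y_1\}\cdots\max\{x_r,y_r\}\cdot(X\times Y)\big),$$ where $x_1,\dots,x_r$ are coordinates on $\Lambda$ (a $\mathbb Z$-basis of $\Lambda^\vee$), $y_1,\dots,y_r$ are the same coordinates on the second factor of $V\times V$, $\pi:\{(x,x) : x\in V\}\to V$ is $(x,x)\mapsto x$, and the push-forward has the weights $\omega_{\pi_*Z}(\sigma')=\sum_{\pi(\sigma)=\sigma'}|\Lambda_{\sigma'}/\pi(\Lambda_\sigma)|\,\omega_Z(\sigma)$. **Lemma.** Let $U,W\subseteq V$ be linear subspaces with rational slope (i.e. spanned by $\Lambda_U:=\Lambda\cap U$ and $\Lambda_W:=\Lambda\cap W$, respectively) such that $U+W=V$, considered as cycles with weight $1$. Then $\Lambda/(\Lambda_U+\Lambda_W)$ is finite, $U\cap W$ has rational slope, and, for every choice of the coordinates $x_1,\dots,x_r$ on $\Lambda$, $$U\cdot W=|\Lambda/(\Lambda_U+\Lambda_W)|\cdot(U\cap W),$$ i.e. $U\cdot W$ is the cycle consisting of the subspace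 $U\cap W$ with weight $|\Lambda/(\Lambda_U+\Lambda_W)|$. -/

import Mathlib

noncomputable section

namespace FanCycle

variable {V : Type*} [AddCommGroup V] [Module ℝ V]
variable {V' : Type*} [AddCommGroup V'] [Module ℝ V']

/-! ### Lattices, cones, primitive vectors -/

/-- The lattice `Λ_L = Λ ∩ L` of a linear subspace `L`. -/
def latticeIn (Λ : Submodule ℤ V) (L : Submodule ℝ V) : Submodule ℤ V :=
  Λ ⊓ L.restrictScalars ℤ

/-- A linear subspace has rational slope if it is spanned by the lattice vectors in it. -/
def IsRationalSubspace (Λ : Submodule ℤ V) (L : Submodule ℝ V) : Prop :=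
  Submodule.span ℝ (latticeIn Λ L : Set V) = L

/-- The quotient group `A / (A ∩ B)`; for `B ≤ A` this is `A / B`. -/
abbrev LatticeQuotient (A B : Submodule ℤ V) : Type _ :=
  A ⧸ B.comap A.subtype

/-- The index `|A / B|` of a sublattice `B ≤ A`. -/
def latticeIndex (A B : Submodule ℤ V) : ℕ :=
  Nat.card (LatticeQuotient A B)

/-- The linear space `V_σ` spanned by a cone `σ`. -/
def coneSpan (σ : PointedCone ℝ V) : Submodule ℝ V :=
  Submodule.span ℝ (σ : Set V)

/-- The dimension of a cone. -/
def coneDim (σ : PointedCone ℝ V) : ℕ :=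
  Module.finrank ℝ (coneSpan σ)

/-- The lattice `Λ_σ = Λ ∩ V_σ` of a cone `σ`. -/
def coneLattice (Λ : Submodule ℤ V) (σ : PointedCone ℝ V) : Submodule ℤ V :=
  latticeIn Λ (coneSpan σ)

/-- A rational polyhedral cone: it is generated by finitely many lattice vectors.
(It may contain linear subspaces.) -/
def IsRationalPolyhedral (Λ : Submodule ℤ V) (σ : PointedCone ℝ V) : Prop :=
  ∃ S : Finset V, (S : Set V) ⊆ Λ ∧ σ = PointedCone.hull ℝ (S : Set V)

/-- `v` is a primitive vector of `σ` modulo its facet `τ`: it is a lattice vector, it points from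
`τ` towards `σ`, i.e. it lies in `σ + V_τ`, and `ℤ v + Λ_τ = Λ_σ`. -/
def IsPrimitiveVector (Λ : Submodule ℤ V) (σ τ : PointedCone ℝ V) (v : V) : Prop :=
  v ∈ Λ ∧ (∃ s ∈ σ, ∃ t ∈ coneSpan τ, v = s + t) ∧
    Submodule.span ℤ {v} ⊔ coneLattice Λ τ = coneLattice Λ σ

/-- A chosen primitive vector `v_{σ/τ}`; it is unique modulo `Λ_τ`. -/
def primitiveVector (Λ : Submodule ℤ V) (σ τ : PointedCone ℝ V) : V :=
  Classical.epsilon (IsPrimitiveVector Λ σ τ)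

/-! ### Weighted fans, refinements, cycles -/

open Classical in
/-- The `d`-dimensional cones of the finite collection `C` that contain `τ`. If `C` is the set of
cones of a fan and `τ` is one of them, these are the `d`-dimensional cones having `τ` as a face. -/
def conesAround (C : Finset (PointedCone ℝ V)) (d : ℕ) (τ : PointedCone ℝ V) :
    Finset (PointedCone ℝ V) :=
  C.filter fun σ => coneDim σ = d ∧ τ ≤ σ

/-- A balanced, weighted, pure-dimensional, rational polyhedral fan in `V` with lattice `Λ`.
Only the values of `weight` on the facets, i.e. the cones of dimension `dim`, are meaningful.
The empty fan is allowed, and so are facets of weight zero. -/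
structure TropicalFan (Λ : Submodule ℤ V) where
  dim : ℕ
  cones : Finset (PointedCone ℝ V)
  weight : PointedCone ℝ V → ℤ
  rational : ∀ σ ∈ cones, IsRationalPolyhedral Λ σ
  face_mem : ∀ σ ∈ cones, ∀ τ : PointedCone ℝ V, τ.IsFaceOf σ → τ ∈ cones
  inter_face : ∀ σ ∈ cones, ∀ σ' ∈ cones, (σ ⊓ σ').IsFaceOf σ
  pure : ∀ τ ∈ cones, ∃ σ ∈ cones, τ ≤ σ ∧ coneDim σ = dim
  balanced : ∀ τ ∈ cones, coneDim τ + 1 = dim →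
    ∑ σ ∈ conesAround cones dim τ, weight σ • primitiveVector Λ σ τ ∈ coneSpan τ

variable {Λ : Submodule ℤ V} {Λ' : Submodule ℤ V'}

/-- `σ` is a facet of `X` of non-zero weight. -/
def IsWeightedFacet (X : TropicalFan Λ) (σ : PointedCone ℝ V) : Prop :=
  σ ∈ X.cones ∧ coneDim σ = X.dim ∧ X.weight σ ≠ 0

/-- The support `|X|`: the union of all facets of non-zero weight. -/
def support (X : TropicalFan Λ) : Set V :=
  {x | ∃ σ, IsWeightedFacet X σ ∧ x ∈ σ}

/-- `Y` is a refinement of `X`, with agreeing weights (facets of weight zero are disregarded). -/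
def IsRefinement (Y X : TropicalFan Λ) : Prop :=
  Y.dim = X.dim ∧ support Y = support X ∧
    ∀ σ, IsWeightedFacet Y σ → ∃ σ', IsWeightedFacet X σ' ∧ σ ≤ σ' ∧ Y.weight σ = X.weight σ'

/-- Two fans define the same cycle if they have a common refinement with agreeing weights. -/
def Equivalent (X Y : TropicalFan Λ) : Prop :=
  ∃ Z : TropicalFan Λ, IsRefinement Z X ∧ IsRefinement Z Y

/-- The cycle `[X]` defined by a fan `X`: the class of all fans equivalent to `X`.
Cycles are handled as such classes of fans. -/
def cycle (X : TropicalFan Λ) : Set (TropicalFan Λ) :=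
  {Y | Equivalent X Y}

/-! ### Linear subspaces as cycles -/

theorem coneSpan_ofSubmodule (L : Submodule ℝ V) :
    coneSpan (PointedCone.ofSubmodule L) = L := by
  simp [coneSpan]

theorem eq_of_isFaceOf_ofSubmodule {L : Submodule ℝ V} {τ : PointedCone ℝ V}
    (h : τ.IsFaceOf (PointedCone.ofSubmodule L)) : τ = PointedCone.ofSubmodule L := by
  refine le_antisymm h.le fun x hx => ?_
  have hx' : -x ∈ PointedCone.ofSubmodule L := L.neg_mem hx
  exact h.mem_of_add_mem_left hx hx' (by simp)

theorem isRationalPolyhedral_ofSubmodule [FiniteDimensional ℝ V] {L : Submodule ℝ V}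
    (hL : IsRationalSubspace Λ L) : IsRationalPolyhedral Λ (PointedCone.ofSubmodule L) := by
  classical
  obtain ⟨T, hT, hTs⟩ := Submodule.fg_span_iff_fg_span_finset_subset (latticeIn Λ L : Set V)
    |>.1 (IsNoetherian.noetherian (Submodule.span ℝ (latticeIn Λ L : Set V)))
  rw [hL] at hTs
  have hTL : ∀ t ∈ T, t ∈ Λ ∧ t ∈ L := fun t ht => hT ht
  refine ⟨T ∪ T.image (fun t => -t), ?_, le_antisymm ?_ ?_⟩
  · intro x hx
    simp only [Finset.coe_union, Finset.coe_image, Set.mem_union, Set.mem_image,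
      Finset.mem_coe] at hx
    rcases hx with hx | ⟨t, ht, rfl⟩
    · exact (hTL x hx).1
    · exact Λ.neg_mem (hTL t ht).1
  · intro x hx
    have hx : x ∈ Submodule.span ℝ (T : Set V) := hTs ▸ hx
    have key : ∀ z ∈ Submodule.span ℝ (T : Set V), ∀ c : ℝ,
        c • z ∈ PointedCone.hull ℝ ((T ∪ T.image (fun t => -t) : Finset V) : Set V) := by
      intro z hz
      induction hz using Submodule.span_induction with
      | mem t ht =>
        intro c
        rcases le_total 0 c with hc | hc
        · exact PointedCone.smul_mem _ hc (Submodule.subset_span (by simp_all))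
        · have : c • t = (-c) • (-t) := by simp
          rw [this]
          exact PointedCone.smul_mem _ (by linarith) (Submodule.subset_span (by simp_all))
      | zero => intro c; simp
      | add _ _ _ _ h₁ h₂ =>
        intro c; rw [smul_add]; exact Submodule.add_mem _ (h₁ c) (h₂ c)
      | smul d _ _ h => intro c; rw [smul_smul]; exact h _
    simpa using key x hx 1
  · refine Submodule.span_le.2 fun x hx => ?_
    simp only [Finset.coe_union, Finset.coe_image, Set.mem_union, Set.mem_image,
      Finset.mem_coe] at hx
    rcases hx with hx | ⟨t, ht, rfl⟩
    · exact (hTL x hx).2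
    · exact L.neg_mem (hTL t ht).2

/-- A rational linear subspace `L` with weight `m`, as a fan whose only cone is `L`. -/
def ofSubspace [FiniteDimensional ℝ V] (L : Submodule ℝ V) (hL : IsRationalSubspace Λ L)
    (m : ℤ) : TropicalFan Λ where
  dim := Module.finrank ℝ L
  cones := {PointedCone.ofSubmodule L}
  weight := fun _ => m
  rational := by
    intro σ hσ
    rw [Finset.mem_singleton.1 hσ]
    exact isRationalPolyhedral_ofSubmodule hL
  face_mem := by
    intro σ hσ τ hτ
    rw [Finset.mem_singleton.1 hσ] at hτ
    exact Finset.mem_singleton.2 (eq_of_isFaceOf_ofSubmodule hτ)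
  inter_face := by
    intro σ hσ σ' hσ'
    rw [Finset.mem_singleton.1 hσ, Finset.mem_singleton.1 hσ', inf_idem]
  pure := by
    intro τ hτ
    refine ⟨τ, hτ, le_rfl, ?_⟩
    rw [Finset.mem_singleton.1 hτ, coneDim, coneSpan_ofSubmodule]
  balanced := by
    intro τ hτ h
    rw [Finset.mem_singleton.1 hτ, coneDim, coneSpan_ofSubmodule] at h
    exact absurd h (Nat.succ_ne_self _)

/-! ### The divisor of a rational function -/

/-- `φ` is a rational function on the fan `X`: it is integer linear on each cone. -/
def IsRationalFunction (φ : V → ℝ) (X : TropicalFan Λ) : Prop :=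
  ∀ σ ∈ X.cones, ∃ l : V →ₗ[ℝ] ℝ,
    (∀ x ∈ σ, φ x = l x) ∧ ∀ x ∈ coneLattice Λ σ, ∃ n : ℤ, l x = n

/-- The linear extension `φ_σ` of `φ|_σ`; its values on `V_σ` are determined by `φ|_σ` if the
latter is linear, and it is only evaluated on `V_σ`. -/
def linearPart (φ : V → ℝ) (σ : PointedCone ℝ V) : V →ₗ[ℝ] ℝ :=
  Classical.epsilon fun l : V →ₗ[ℝ] ℝ => ∀ x ∈ σ, φ x = l x

/-- The weight of a ridge `τ` of `X` in the divisor of `φ`: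
`∑_σ ω(σ) φ_σ(v_{σ/τ}) - φ_τ(∑_σ ω(σ) v_{σ/τ})`, summed over the facets `σ` around `τ`. -/
def divisorWeight (φ : V → ℝ) (X : TropicalFan Λ) (τ : PointedCone ℝ V) : ℝ :=
  ∑ σ ∈ conesAround X.cones X.dim τ,
      (X.weight σ : ℝ) * linearPart φ σ (primitiveVector Λ σ τ)
    - linearPart φ τ (∑ σ ∈ conesAround X.cones X.dim τ, X.weight σ • primitiveVector Λ σ τ)

open Classical in
/-- `D` is the divisor `φ · X` of a rational function `φ` on the fan `X`: the codimension one
skeleton of `X` with the weights `divisorWeight` on the ridges. (For `dim X = 0` the skeleton is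
empty, and `D` is the zero cycle.) -/
def IsDivisor (φ : V → ℝ) (X D : TropicalFan Λ) : Prop :=
  IsRationalFunction φ X ∧
  D.dim = X.dim - 1 ∧
  D.cones = X.cones.filter (fun σ => coneDim σ < X.dim) ∧
  ∀ τ ∈ X.cones, coneDim τ + 1 = X.dim → (D.weight τ : ℝ) = divisorWeight φ X τ

/-- `φ · [X] = [φ · X]` for any fan `X` in the class on which `φ` is a rational function. -/
def divisor (φ : V → ℝ) (C : Set (TropicalFan Λ)) : Set (TropicalFan Λ) :=
  {Z | ∃ X ∈ C, ∃ D, IsDivisor φ X D ∧ Z ∈ cycle D}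

/-! ### Cartesian products and push-forward -/

open Classical in
/-- `P` is the cartesian product `X × Y` of the fans `X` and `Y`. -/
def IsCartesianProduct (X : TropicalFan Λ) (Y : TropicalFan Λ') (P : TropicalFan (Λ.prod Λ')) :
    Prop :=
  P.dim = X.dim + Y.dim ∧
  P.cones = Finset.image₂ (fun σ σ' => Submodule.prod σ σ') X.cones Y.cones ∧
  ∀ σ ∈ X.cones, ∀ σ' ∈ Y.cones, coneDim σ = X.dim → coneDim σ' = Y.dim →
    P.weight (Submodule.prod σ σ') = X.weight σ * Y.weight σ'

/-- The cartesian product `[X] × [Y] = [X × Y]` of cycles. -/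
def cartesianProduct (C : Set (TropicalFan Λ)) (C' : Set (TropicalFan Λ')) :
    Set (TropicalFan (Λ.prod Λ')) :=
  {Z | ∃ X ∈ C, ∃ Y ∈ C', ∃ P, IsCartesianProduct X Y P ∧ Z ∈ cycle P}

open Classical in
/-- `Y` is the push-forward `f_* X` of the fan `X` along the linear map `f`, which maps `Λ` to
`Λ'`: the images of the facets of `X` on which `f` is injective are cones of `Y`, and a facet `σ'`
of `Y` has weight `∑ |Λ'_{σ'} / f(Λ_σ)| ω(σ)`, summed over the facets `σ` of `X` with
`f(σ) = σ'`. -/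
def IsPushforward (f : V →ₗ[ℝ] V') (X : TropicalFan Λ) (Y : TropicalFan Λ') : Prop :=
  (∀ v ∈ Λ, f v ∈ Λ') ∧
  Y.dim = X.dim ∧
  (∀ σ ∈ X.cones, coneDim σ = X.dim → coneDim (σ.map f) = X.dim → σ.map f ∈ Y.cones) ∧
  ∀ σ' ∈ Y.cones, coneDim σ' = Y.dim →
    Y.weight σ' = ∑ σ ∈ X.cones.filter (fun σ => coneDim σ = X.dim ∧ σ.map f = σ'),
      (latticeIndex (coneLattice Λ' σ')
        ((coneLattice Λ σ).map (f.restrictScalars ℤ)) : ℤ) * X.weight σ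

/-- `f_* [X] = [f_* X]` for any fan `X` in the class that is fine enough. -/
def pushforward (Λ' : Submodule ℤ V') (f : V →ₗ[ℝ] V') (C : Set (TropicalFan Λ)) :
    Set (TropicalFan Λ') :=
  {Z | ∃ X ∈ C, ∃ Y : TropicalFan Λ', IsPushforward f X Y ∧ Z ∈ cycle Y}

/-! ### The intersection product -/

/-- The iterated product `φ₁ · (φ₂ · ( ⋯ (φᵣ · C)))`. -/
def divisors {r : ℕ} (φ : Fin r → V → ℝ) (C : Set (TropicalFan Λ)) : Set (TropicalFan Λ) :=
  (List.ofFn φ).foldr divisor C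

/-- The intersection product `C · C' = π_* (max{x₁,y₁} ⋯ max{xᵣ,yᵣ} · (C × C'))` of two cycles in
`V`, computed in the coordinates `x₁, …, xᵣ` on `V`. Here `π` is induced by the first projection
`V × V → V`, whose restriction to the diagonal is `(x, x) ↦ x`. -/
def intersectionProduct {r : ℕ} (x : Fin r → V →ₗ[ℝ] ℝ) (C C' : Set (TropicalFan Λ)) :
    Set (TropicalFan Λ) :=
  pushforward Λ (LinearMap.fst ℝ V V)
    (divisors (fun i (p : V × V) => max (x i p.1) (x i p.2)) (cartesianProduct C C'))

end FanCycle

end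

noncomputable section
namespace FanCycle
variable {V : Type*} [AddCommGroup V] [Module ℝ V]
variable {V' : Type*} [AddCommGroup V'] [Module ℝ V']
variable {Λ : Submodule ℤ V} {Λ' : Submodule ℤ V'}

section

/-! ### Convexity -/

theorem le_coneSpan {σ : PointedCone ℝ V} {x : V} (hx : x ∈ σ) : x ∈ coneSpan σ :=
  Submodule.subset_span hx

theorem coneSpan_le {σ : PointedCone ℝ V} {L : Submodule ℝ V} :
    coneSpan σ ≤ L ↔ ∀ x ∈ σ, x ∈ L :=
  Submodule.span_le

theorem coneSpan_mono {σ τ : PointedCone ℝ V} (h : σ ≤ τ) : coneSpan σ ≤ coneSpan τ :=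
  Submodule.span_mono h

theorem exists_sub_of_mem_coneSpan {σ : PointedCone ℝ V} {x : V} (hx : x ∈ coneSpan σ) :
    ∃ a ∈ σ, ∃ b ∈ σ, x = a - b := by
  induction hx using Submodule.span_induction with
  | mem x h => exact ⟨x, h, 0, zero_mem _, by simp⟩
  | zero => exact ⟨0, zero_mem _, 0, zero_mem _, by simp⟩
  | add x y _ _ hx hy =>
    obtain ⟨a, ha, b, hb, rfl⟩ := hx
    obtain ⟨c, hc, d, hd, rfl⟩ := hy
    exact ⟨a + c, add_mem ha hc, b + d, add_mem hb hd, by abel⟩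
  | smul c x _ hx =>
    obtain ⟨a, ha, b, hb, rfl⟩ := hx
    rcases le_total 0 c with h | h
    · exact ⟨c • a, σ.smul_mem h ha, c • b, σ.smul_mem h hb, smul_sub _ _ _⟩
    · exact ⟨(-c) • b, σ.smul_mem (by linarith) hb, (-c) • a, σ.smul_mem (by linarith) ha, by
        rw [smul_sub, neg_smul, neg_smul]; abel⟩

/-- A face of a cone that spans the same space is the whole cone. -/
theorem eq_of_isFaceOf_of_coneSpan_le {σ F : PointedCone ℝ V} (hF : F.IsFaceOf σ)
    (h : coneSpan σ ≤ coneSpan F) : F = σ := by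
  refine le_antisymm hF.le fun x hx => ?_
  obtain ⟨a, ha, b, hb, e⟩ := exists_sub_of_mem_coneSpan (h (le_coneSpan hx))
  refine hF.mem_of_add_mem_left hx (hF.le hb) ?_
  rw [e, sub_add_cancel]
  exact ha

/-- A cone contained in none of finitely many subspaces is not contained in their union. -/
theorem exists_mem_forall_notMem (σ : PointedCone ℝ V) (s : Finset (Submodule ℝ V))
    (hs : ∀ q ∈ s, ∃ x ∈ σ, x ∉ q) : ∃ x ∈ σ, ∀ q ∈ s, x ∉ q := by
  classical
  induction s using Finset.induction_on with
  | empty => exact ⟨0, zero_mem _, by simp⟩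
  | insert p s hp ih =>
    obtain ⟨x, hx, hxs⟩ := ih fun q hq => hs q (Finset.mem_insert_of_mem hq)
    obtain ⟨y, hy, hyp⟩ := hs p (Finset.mem_insert_self _ _)
    -- Two such parameters would put y, and then x, into q; but y avoids p and x avoids all of s. So
    -- only finitely many t > 0 are bad.
    have hsub : ∀ q ∈ insert p s, {t : ℝ | x + t • y ∈ q}.Subsingleton := by
      intro q hq t ht t' ht'
      by_contra hne
      have hyq : y ∈ q := by
        have h1 := q.sub_mem ht ht'
        have e : x + t • y - (x + t' • y) = (t - t') • y := by rw [sub_smul]; abel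
        rw [e] at h1
        exact (q.smul_mem_iff (sub_ne_zero.2 hne)).1 h1
      rcases Finset.mem_insert.1 hq with rfl | hq
      · exact hyp hyq
      · exact hxs q hq ((q.add_mem_iff_left (q.smul_mem t hyq)).1 ht)
    have hfin : (⋃ q ∈ insert p s, {t : ℝ | x + t • y ∈ q}).Finite :=
      (insert p s).finite_toSet.biUnion fun q hq => (hsub q hq).finite
    obtain ⟨t, ht, hnot⟩ := (Set.Ioi_infinite (0 : ℝ)).exists_notMem_finite hfin
    refine ⟨x + t • y, add_mem hx (σ.smul_mem (le_of_lt ht) hy), fun q hq hmem => hnot ?_⟩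
    exact Set.mem_biUnion hq hmem

/-- One step of Fourier–Motzkin elimination. -/
theorem exists_halfspaces_add_ray (F : Finset (V →ₗ[ℝ] ℝ)) (s : V) :
    ∃ G : Finset (V →ₗ[ℝ] ℝ), ∀ x, (∀ l ∈ G, 0 ≤ l x) ↔ ∃ c : ℝ, 0 ≤ c ∧
      ∀ l ∈ F, 0 ≤ l (x - c • s) := by
  classical
  refine ⟨F.filter (fun l => 0 ≤ l s) ∪
    Finset.image₂ (fun l l' => l s • l' - l' s • l) (F.filter fun l => 0 < l s)
      (F.filter fun l => l s < 0), fun x => ⟨fun h => ?_, ?_⟩⟩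
  · have h1 : ∀ l ∈ F, 0 ≤ l s → 0 ≤ l x := fun l hl hs =>
      h l (Finset.mem_union_left _ (Finset.mem_filter.2 ⟨hl, hs⟩))
    have h2 : ∀ l ∈ F, ∀ l' ∈ F, 0 < l s → l' s < 0 → 0 ≤ l s * l' x - l' s * l x := by
      intro l hl l' hl' hs hs'
      have := h (l s • l' - l' s • l) (Finset.mem_union_right _ (Finset.mem_image₂_of_mem
        (Finset.mem_filter.2 ⟨hl, hs⟩) (Finset.mem_filter.2 ⟨hl', hs'⟩)))
      simpa using this
    -- Forms with l s < 0 bound c from below by l x / l s, those with l s > 0 bound it from above.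
    -- The largest lower bound works, since the mixed combinations in G say that no lower bound
    -- exceeds an upper one.
    let A : Finset ℝ := insert 0 ((F.filter fun l => l s < 0).image fun l => l x / l s)
    have hA : A.Nonempty := Finset.insert_nonempty _ _
    refine ⟨A.max' hA, A.le_max' 0 (Finset.mem_insert_self _ _), fun l hl => ?_⟩
    rw [map_sub, map_smul, smul_eq_mul, sub_nonneg]
    rcases lt_trichotomy (l s) 0 with hs | hs | hs
    · have : l x / l s ≤ A.max' hA := A.le_max' _ (Finset.mem_insert_of_mem
        (Finset.mem_image_of_mem _ (Finset.mem_filter.2 ⟨hl, hs⟩)))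
      rwa [div_le_iff_of_neg hs] at this
    · rw [hs, mul_zero]; exact h1 l hl hs.ge
    · rw [← le_div_iff₀ hs]
      refine A.max'_le hA _ fun y hy => ?_
      rcases Finset.mem_insert.1 hy with rfl | hy
      · exact div_nonneg (h1 l hl hs.le) hs.le
      · obtain ⟨l', hl', rfl⟩ := Finset.mem_image.1 hy
        obtain ⟨hl', hs'⟩ := Finset.mem_filter.1 hl'
        rw [div_le_iff_of_neg hs', div_mul_eq_mul_div, div_le_iff₀ hs]
        linarith [h2 l hl l' hl' hs hs']
  · rintro ⟨c, hc, h⟩ l hl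
    simp only [map_sub, map_smul, smul_eq_mul, sub_nonneg] at h
    rcases Finset.mem_union.1 hl with hl | hl
    · obtain ⟨hl, hs⟩ := Finset.mem_filter.1 hl
      exact (mul_nonneg hc hs).trans (h l hl)
    · obtain ⟨a, ha, b, hb, rfl⟩ := Finset.mem_image₂.1 hl
      obtain ⟨ha, hsa⟩ := Finset.mem_filter.1 ha
      obtain ⟨hb, hsb⟩ := Finset.mem_filter.1 hb
      have h1 := mul_le_mul_of_nonneg_left (h b hb) hsa.le
      have h2 := mul_le_mul_of_nonneg_left (h a ha) (neg_nonneg.2 hsb.le)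
      simp only [LinearMap.sub_apply, LinearMap.smul_apply, smul_eq_mul]
      linarith

/-- A finitely generated cone is a finite intersection of half-spaces. -/
theorem exists_halfspaces [FiniteDimensional ℝ V] (S : Finset V) :
    ∃ F : Finset (V →ₗ[ℝ] ℝ), ∀ x, x ∈ PointedCone.hull ℝ (S : Set V) ↔ ∀ l ∈ F, 0 ≤ l x := by
  classical
  induction S using Finset.induction_on with
  | empty =>
    let b := Module.finBasis ℝ V
    refine ⟨Finset.univ.image b.coord ∪ Finset.univ.image (fun i => -b.coord i),
      fun x => ⟨fun hx l _ => ?_, fun h => ?_⟩⟩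
    · have : x = 0 := by simpa using hx
      simp [this]
    · have : x = 0 := by
        refine b.ext_elem_iff.2 fun i => ?_
        have h1 := h (b.coord i) (by simp)
        have h2 := h (-b.coord i) (by simp)
        simp only [LinearMap.neg_apply, Module.Basis.coord_apply] at h1 h2
        simp only [map_zero, Finsupp.coe_zero, Pi.zero_apply]
        linarith
      rw [this]
      exact zero_mem _
  | insert s S _ ih =>
    obtain ⟨F, hF⟩ := ih
    obtain ⟨G, hG⟩ := exists_halfspaces_add_ray F s
    refine ⟨G, fun x => ?_⟩
    rw [hG, Finset.coe_insert, PointedCone.hull, Submodule.mem_span_insert]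
    constructor
    · rintro ⟨a, z, hz, rfl⟩
      refine ⟨a, a.2, (hF _).1 ?_⟩
      have e : a • s + z - (a : ℝ) • s = z := add_sub_cancel_left _ _
      rwa [e]
    · rintro ⟨c, hc, h⟩
      exact ⟨⟨c, hc⟩, _, (hF _).2 h, (add_sub_cancel (c • s) x).symm⟩

theorem IsRationalPolyhedral.exists_halfspaces [FiniteDimensional ℝ V] {σ : PointedCone ℝ V}
    (hσ : IsRationalPolyhedral Λ σ) :
    ∃ F : Finset (V →ₗ[ℝ] ℝ), ∀ x, x ∈ σ ↔ ∀ l ∈ F, 0 ≤ l x := by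
  obtain ⟨S, -, rfl⟩ := hσ
  exact FanCycle.exists_halfspaces S

/-- Polyhedral cones are closed along rays. -/
theorem IsRationalPolyhedral.mem_of_frequently [FiniteDimensional ℝ V] {σ : PointedCone ℝ V}
    (hσ : IsRationalPolyhedral Λ σ) {x p : V}
    (h : ∀ δ > (0 : ℝ), ∃ ε > 0, ε ≤ δ ∧ x + ε • p ∈ σ) : x ∈ σ := by
  obtain ⟨F, hF⟩ := hσ.exists_halfspaces
  refine (hF x).2 fun l hl => ?_
  by_contra! hneg
  -- For ε up to this bound, ε * l p is at most half of -l x, so l is still negative at x + ε p.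
  obtain ⟨ε, hε, hle, hmem⟩ := h (-l x / (2 * (|l p| + 1))) (by
    have := abs_nonneg (l p); apply div_pos <;> linarith)
  have h1 := (hF _).1 hmem l hl
  rw [map_add, map_smul, smul_eq_mul] at h1
  have hpos : 0 < 2 * (|l p| + 1) := by positivity
  rw [le_div_iff₀ hpos] at hle
  nlinarith [le_abs_self (l p), mul_le_mul_of_nonneg_left (le_abs_self (l p)) hε.le]

/-- If finitely many polyhedral cones cover a ray segment's points `x + ε p`, one of them contains
both `x` and such a point. -/
theorem exists_mem_and_add_smul_mem [FiniteDimensional ℝ V] (s : Finset (PointedCone ℝ V))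
    (hs : ∀ σ ∈ s, IsRationalPolyhedral Λ σ) {x p : V}
    (h : ∀ ε > (0 : ℝ), ∃ σ ∈ s, x + ε • p ∈ σ) :
    ∃ σ ∈ s, x ∈ σ ∧ ∃ ε > (0 : ℝ), x + ε • p ∈ σ := by
  classical
  suffices H : ∃ σ ∈ s, ∀ δ > (0 : ℝ), ∃ ε > 0, ε ≤ δ ∧ x + ε • p ∈ σ by
    obtain ⟨σ, hσ, H⟩ := H
    obtain ⟨ε, hε, -, hmem⟩ := H 1 one_pos
    exact ⟨σ, hσ, (hs σ hσ).mem_of_frequently H, ε, hε, hmem⟩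
  by_contra! hcon
  choose! δ hδ hnot using hcon
  obtain ⟨ε, hε, hle⟩ : ∃ ε > (0 : ℝ), ∀ σ ∈ s, ε ≤ δ σ := by
    refine ⟨(insert 1 (s.image δ)).min' (Finset.insert_nonempty _ _), ?_, fun σ hσ =>
      Finset.min'_le _ _ (Finset.mem_insert_of_mem (Finset.mem_image_of_mem _ hσ))⟩
    rw [gt_iff_lt, Finset.lt_min'_iff]
    intro y hy
    rcases Finset.mem_insert.1 hy with rfl | hy
    · exact one_pos
    · obtain ⟨σ, hσ, rfl⟩ := Finset.mem_image.1 hy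
      exact hδ σ hσ
  obtain ⟨σ, hσ, hmem⟩ := h ε hε
  exact hnot σ hσ ε hε (hle σ hσ) hmem

/-- A finitely generated cone has a relative interior point. -/
theorem IsRationalPolyhedral.exists_relint {σ : PointedCone ℝ V}
    (hσ : IsRationalPolyhedral Λ σ) :
    ∃ p ∈ σ, ∀ t ∈ coneSpan σ, ∃ ε > (0 : ℝ), p + ε • t ∈ σ := by
  classical
  obtain ⟨S, -, rfl⟩ := hσ
  set σ := PointedCone.hull ℝ (S : Set V)
  have hS : ∀ s ∈ S, s ∈ σ := fun s hs => Submodule.subset_span hs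
  have hp : ∑ s ∈ S, s ∈ σ := sum_mem hS
  -- The sum of the generators is interior: a generator can be subtracted by dropping its summand,
  -- and convex combinations extend this to the whole cone.
  have key : ∀ b ∈ σ, ∃ ε > (0 : ℝ), ∑ s ∈ S, s - ε • b ∈ σ := by
    intro b hb
    induction hb using Submodule.span_induction with
    | mem x hx =>
      refine ⟨1, one_pos, ?_⟩
      rw [one_smul, ← Finset.sum_erase_eq_sub hx]
      exact sum_mem fun s hs => hS s (Finset.mem_of_mem_erase hs)
    | zero => exact ⟨1, one_pos, by simpa using hp⟩
    | add x y _ _ hx hy =>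
      obtain ⟨a, ha, hx⟩ := hx
      obtain ⟨b, hb, hy⟩ := hy
      refine ⟨a * b / (a + b), by positivity, ?_⟩
      have := add_mem (σ.smul_mem (by positivity : 0 ≤ b / (a + b)) hx)
        (σ.smul_mem (by positivity : 0 ≤ a / (a + b)) hy)
      convert this using 1
      have hab : a + b ≠ 0 := by positivity
      match_scalars <;> field_simp
      ring
    | smul c x _ hx =>
      obtain ⟨c, hc⟩ := c
      obtain ⟨a, ha, hx⟩ := hx
      -- The denominator is c + 1 rather than c because c may be zero.
      refine ⟨a / (c + 1), by positivity, ?_⟩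
      have := add_mem (σ.smul_mem (by positivity : 0 ≤ c / (c + 1)) hx)
        (σ.smul_mem (by positivity : 0 ≤ 1 / (c + 1)) hp)
      convert this using 1
      have : c + 1 ≠ 0 := by positivity
      rw [show (⟨c, hc⟩ : NNReal) • x = c • x from rfl]
      match_scalars <;> field_simp
  refine ⟨∑ s ∈ S, s, hp, fun t ht => ?_⟩
  obtain ⟨a, ha, b, hb, rfl⟩ := exists_sub_of_mem_coneSpan ht
  obtain ⟨ε, hε, h⟩ := key b hb
  refine ⟨ε, hε, ?_⟩
  have := add_mem h (σ.smul_mem hε.le ha)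
  convert this using 1
  rw [smul_sub]
  abel

/-- A face containing a relative interior point is the whole cone. -/
theorem eq_of_isFaceOf_of_relint_mem {τ F : PointedCone ℝ V} (hF : F.IsFaceOf τ) {p : V}
    (hp : ∀ t ∈ coneSpan τ, ∃ ε > (0 : ℝ), p + ε • t ∈ τ) (hpF : p ∈ F) : F = τ := by
  refine le_antisymm hF.le fun y hy => ?_
  obtain ⟨ε, hε, h⟩ := hp (-y) (neg_mem (le_coneSpan hy))
  refine hF.mem_of_smul_add_mem hy h hε ?_
  rwa [smul_neg, add_neg_cancel_comm_assoc]

/-! ### Fans representing a weighted subspace -/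

theorem TropicalFan.isFaceOf_of_le (X : TropicalFan Λ) {τ σ : PointedCone ℝ V}
    (hτ : τ ∈ X.cones) (hσ : σ ∈ X.cones) (h : τ ≤ σ) : τ.IsFaceOf σ := by
  have := X.inter_face σ hσ τ hτ
  rwa [inf_eq_right.2 h] at this

theorem TropicalFan.coneDim_le [FiniteDimensional ℝ V] (X : TropicalFan Λ) {σ : PointedCone ℝ V}
    (hσ : σ ∈ X.cones) : coneDim σ ≤ X.dim := by
  obtain ⟨σ', -, hle, hdim⟩ := X.pure σ hσ
  exact hdim ▸ Submodule.finrank_mono (coneSpan_mono hle)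

/-- Two cones of a fan are equal if their intersection spans the span of each of them. -/
theorem TropicalFan.eq_of_coneSpan_le_inf (X : TropicalFan Λ) {σ σ' : PointedCone ℝ V}
    (hσ : σ ∈ X.cones) (hσ' : σ' ∈ X.cones) (h : coneSpan σ ≤ coneSpan (σ ⊓ σ'))
    (h' : coneSpan σ' ≤ coneSpan (σ ⊓ σ')) : σ = σ' := by
  have h1 := eq_of_isFaceOf_of_coneSpan_le (X.inter_face σ hσ σ' hσ') h
  rw [inf_comm] at h'
  have h2 := eq_of_isFaceOf_of_coneSpan_le (X.inter_face σ' hσ' σ hσ) h'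
  rw [← h1, inf_comm, h2]

/-- `X` is a subdivision of the subspace `L` with constant weight `m`, up to facets of weight
zero. -/
structure RepresentsSubspace (X : TropicalFan Λ) (L : Submodule ℝ V) (m : ℤ) : Prop where
  dim_eq : X.dim = Module.finrank ℝ L
  support_eq : support X = L
  weight_eq : ∀ σ, IsWeightedFacet X σ → X.weight σ = m

namespace RepresentsSubspace

variable {X Y : TropicalFan Λ} {L : Submodule ℝ V} {m : ℤ}

theorem mem_of_isWeightedFacet (h : RepresentsSubspace X L m) {σ : PointedCone ℝ V}
    (hσ : IsWeightedFacet X σ) {x : V} (hx : x ∈ σ) : x ∈ L := by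
  have : x ∈ support X := ⟨σ, hσ, hx⟩
  rwa [h.support_eq] at this

theorem exists_isWeightedFacet (h : RepresentsSubspace X L m) {x : V} (hx : x ∈ L) :
    ∃ σ, IsWeightedFacet X σ ∧ x ∈ σ := by
  have : x ∈ support X := by rwa [h.support_eq]
  exact this

theorem of_isRefinement (h : RepresentsSubspace X L m) (hYX : IsRefinement Y X) :
    RepresentsSubspace Y L m where
  dim_eq := hYX.1.trans h.dim_eq
  support_eq := hYX.2.1.trans h.support_eq
  weight_eq σ hσ := by
    obtain ⟨σ', hσ', -, e⟩ := hYX.2.2 σ hσ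
    exact e.trans (h.weight_eq σ' hσ')

variable [FiniteDimensional ℝ V]

theorem coneSpan_eq (h : RepresentsSubspace X L m) {σ : PointedCone ℝ V}
    (hσ : IsWeightedFacet X σ) : coneSpan σ = L :=
  Submodule.eq_of_le_of_finrank_eq (coneSpan_le.2 fun _ hx => h.mem_of_isWeightedFacet hσ hx)
    (hσ.2.1.trans h.dim_eq)

/-- A point of σ outside all proper subspaces spanned by some σ ⊓ ρ lies in a weighted facet ρ of Y,
so σ ⊓ ρ spans L. Then σ also meets the facet of X containing ρ in full dimension, hence equals it
and inherits the weight of ρ. -/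
theorem coarsen (h : RepresentsSubspace Y L m) (hYX : IsRefinement Y X) :
    RepresentsSubspace X L m where
  dim_eq := hYX.1.symm.trans h.dim_eq
  support_eq := hYX.2.1.symm.trans h.support_eq
  weight_eq σ hσ := by
    classical
    have hdim : X.dim = Module.finrank ℝ L := hYX.1.symm.trans h.dim_eq
    have hsupp : support X = L := hYX.2.1.symm.trans h.support_eq
    have hspan : ∀ ρ, IsWeightedFacet X ρ → coneSpan ρ = L := fun ρ hρ =>
      Submodule.eq_of_le_of_finrank_eq (coneSpan_le.2 fun x hx => by
        have : x ∈ support X := ⟨ρ, hρ, hx⟩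
        rwa [hsupp] at this) (hρ.2.1.trans hdim)
    obtain ⟨p, hp, hnot⟩ := exists_mem_forall_notMem σ
      (((Y.cones.image fun ρ => coneSpan (σ ⊓ ρ))).filter fun q => ∃ x ∈ σ, x ∉ q)
      (fun q hq => (Finset.mem_filter.1 hq).2)
    obtain ⟨ρ, hρ, hpρ⟩ := h.exists_isWeightedFacet (hspan σ hσ ▸ le_coneSpan hp)
    have hle : coneSpan σ ≤ coneSpan (σ ⊓ ρ) := by
      by_contra hcon
      rw [coneSpan_le] at hcon
      push Not at hcon
      exact hnot _ (Finset.mem_filter.2 ⟨Finset.mem_image_of_mem _ hρ.1, hcon⟩)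
        (le_coneSpan ⟨hp, hpρ⟩)
    obtain ⟨σ', hσ', hρσ', e⟩ := hYX.2.2 ρ hρ
    have hle' : coneSpan σ ≤ coneSpan (σ ⊓ σ') :=
      hle.trans (coneSpan_mono (inf_le_inf_left _ hρσ'))
    have : σ = σ' := X.eq_of_coneSpan_le_inf hσ.1 hσ'.1 hle'
      (((hspan σ' hσ').trans (hspan σ hσ).symm).le.trans hle')
    rw [this, ← e, h.weight_eq ρ hρ]

theorem of_mem_cycle (h : RepresentsSubspace X L m) (hY : Y ∈ cycle X) :
    RepresentsSubspace Y L m := by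
  obtain ⟨Z, hZX, hZY⟩ := hY
  exact (h.of_isRefinement hZX).coarsen hZY

end RepresentsSubspace

theorem isRefinement_refl (X : TropicalFan Λ) : IsRefinement X X :=
  ⟨rfl, rfl, fun σ hσ => ⟨σ, hσ, le_rfl, rfl⟩⟩

variable [FiniteDimensional ℝ V]

theorem isWeightedFacet_ofSubspace {L : Submodule ℝ V} {hL : IsRationalSubspace Λ L} {m : ℤ}
    (hm : m ≠ 0) {σ : PointedCone ℝ V} :
    IsWeightedFacet (ofSubspace L hL m) σ ↔ σ = PointedCone.ofSubmodule L := by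
  constructor
  · exact fun h => Finset.mem_singleton.1 h.1
  · rintro rfl
    exact ⟨Finset.mem_singleton_self _, by rw [coneDim, coneSpan_ofSubmodule]; rfl, hm⟩

theorem representsSubspace_ofSubspace (L : Submodule ℝ V) (hL : IsRationalSubspace Λ L) {m : ℤ}
    (hm : m ≠ 0) : RepresentsSubspace (ofSubspace L hL m) L m where
  dim_eq := rfl
  support_eq := by
    ext x
    simp [support, isWeightedFacet_ofSubspace hm]
  weight_eq _ _ := rfl

/-- The fans equivalent to a subspace `L` of non-zero weight `m` are those representing it. -/
theorem mem_cycle_ofSubspace_iff {L : Submodule ℝ V} (hL : IsRationalSubspace Λ L) {m : ℤ}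
    (hm : m ≠ 0) {X : TropicalFan Λ} :
    X ∈ cycle (ofSubspace L hL m) ↔ RepresentsSubspace X L m := by
  refine ⟨(representsSubspace_ofSubspace L hL hm).of_mem_cycle, fun h => ⟨X, ⟨h.dim_eq, ?_, ?_⟩,
    isRefinement_refl X⟩⟩
  · rw [h.support_eq, (representsSubspace_ofSubspace L hL hm).support_eq]
  · exact fun σ hσ => ⟨_, (isWeightedFacet_ofSubspace hm).2 rfl,
      fun x hx => h.mem_of_isWeightedFacet hσ hx, h.weight_eq σ hσ⟩

end

/-! ### Integral linear forms and primitive vectors -/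

/-- The linear form `g` has integer values on the lattice `M`. -/
def IsIntegerValued (M : Submodule ℤ V) (g : V →ₗ[ℝ] ℝ) : Prop :=
  ∀ v ∈ M, ∃ n : ℤ, g v = n

/-- `g` maps the lattice `M` onto `ℤ c`, and `c` is positive. -/
structure IsGenerator (g : V →ₗ[ℝ] ℝ) (M : Submodule ℤ V) (c : ℤ) : Prop where
  pos : 0 < c
  exists_eq_mul : ∀ v ∈ M, ∃ n : ℤ, g v = n * c
  exists_eq : ∃ v ∈ M, g v = c

theorem IsGenerator.neg {g : V →ₗ[ℝ] ℝ} {M : Submodule ℤ V} {c : ℤ} (h : IsGenerator g M c) :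
    IsGenerator (-g) M c where
  pos := h.pos
  exists_eq_mul v hv := by
    obtain ⟨n, hn⟩ := h.exists_eq_mul v hv
    exact ⟨-n, by simp [hn]⟩
  exists_eq := by
    obtain ⟨v, hv, e⟩ := h.exists_eq
    exact ⟨-v, neg_mem hv, by simp [e]⟩

/-- The values of g on M form a nonzero subgroup of ℤ, which is cyclic. -/
theorem IsIntegerValued.exists_isGenerator {g : V →ₗ[ℝ] ℝ} {M : Submodule ℤ V} (hg : IsIntegerValued M g)
    (h : ∃ v ∈ M, g v ≠ 0) : ∃ c, IsGenerator g M c := by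
  let G : AddSubgroup ℤ :=
    { carrier := {n | ∃ v ∈ M, g v = n}
      add_mem' := by
        rintro a b ⟨v, hv, e⟩ ⟨w, hw, e'⟩
        exact ⟨v + w, add_mem hv hw, by simp [e, e']⟩
      zero_mem' := ⟨0, zero_mem _, by simp⟩
      neg_mem' := by
        rintro a ⟨v, hv, e⟩
        exact ⟨-v, neg_mem hv, by simp [e]⟩ }
  obtain ⟨a, ha⟩ := Int.subgroup_cyclic G
  have hG : ∀ n, n ∈ G ↔ ∃ k : ℤ, k * a = n := fun n => by
    rw [ha, AddSubgroup.mem_closure_singleton]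
    simp
  have ha0 : a ≠ 0 := by
    rintro rfl
    obtain ⟨v, hv, hne⟩ := h
    obtain ⟨n, hn⟩ := hg v hv
    obtain ⟨k, hk⟩ := (hG n).1 ⟨v, hv, hn⟩
    rw [mul_zero] at hk
    exact hne (by rw [hn, ← hk, Int.cast_zero])
  refine ⟨|a|, abs_pos.2 ha0, fun v hv => ?_, ?_⟩
  · obtain ⟨n, hn⟩ := hg v hv
    obtain ⟨k, hk⟩ := (hG n).1 ⟨v, hv, hn⟩
    rcases abs_choice a with e | e
    · exact ⟨k, by rw [hn, e, ← hk]; push_cast; ring⟩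
    · exact ⟨-k, by rw [hn, e, ← hk]; push_cast; ring⟩
  · have : |a| ∈ G := (hG _).2 <| by
      rcases abs_choice a with e | e
      · exact ⟨1, by rw [e]; ring⟩
      · exact ⟨-1, by rw [e]; ring⟩
    exact this

theorem latticeIn_mono {L L' : Submodule ℝ V} (h : L ≤ L') : latticeIn Λ L ≤ latticeIn Λ L' :=
  inf_le_inf_left _ h

/-- A rational subspace is not contained in a subspace missing some of its points. -/
theorem IsRationalSubspace.exists_mem_notMem {L q : Submodule ℝ V} (hL : IsRationalSubspace Λ L)
    (h : ∃ v ∈ L, v ∉ q) : ∃ v ∈ latticeIn Λ L, v ∉ q := by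
  by_contra! hcon
  obtain ⟨v, hv, hvq⟩ := h
  rw [← hL] at hv
  exact hvq (Submodule.span_le.2 hcon hv)

theorem IsRationalSubspace.exists_apply_ne_zero {L : Submodule ℝ V} (hL : IsRationalSubspace Λ L)
    {g : V →ₗ[ℝ] ℝ} (h : ∃ v ∈ L, g v ≠ 0) : ∃ v ∈ latticeIn Λ L, g v ≠ 0 :=
  hL.exists_mem_notMem (q := LinearMap.ker g) h

theorem IsRationalPolyhedral.isRationalSubspace {σ : PointedCone ℝ V}
    (hσ : IsRationalPolyhedral Λ σ) : IsRationalSubspace Λ (coneSpan σ) := by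
  refine le_antisymm (Submodule.span_le.2 fun x hx => hx.2) ?_
  obtain ⟨S, hS, rfl⟩ := hσ
  refine coneSpan_le.2 fun x hx => Submodule.span_mono ?_ (PointedCone.hull_le_span ℝ _ hx)
  exact fun s hs => ⟨hS hs, le_coneSpan (Submodule.subset_span hs)⟩

theorem finrank_inf_ker_add_one [FiniteDimensional ℝ V] {L : Submodule ℝ V} {g : V →ₗ[ℝ] ℝ}
    (h : ∃ v ∈ L, g v ≠ 0) :
    Module.finrank ℝ (L ⊓ LinearMap.ker g : Submodule ℝ V) + 1 = Module.finrank ℝ L := by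
  have h0 : g.domRestrict L ≠ 0 := by
    obtain ⟨v, hv, hne⟩ := h
    intro e
    exact hne (LinearMap.congr_fun e ⟨v, hv⟩)
  rw [← Module.Dual.finrank_ker_add_one_of_ne_zero h0, ← Submodule.map_comap_subtype,
    Submodule.finrank_map_subtype_eq]
  rfl

/-- Rational subspaces are cut by integral linear forms into rational subspaces. -/
theorem IsRationalSubspace.inf_ker {L : Submodule ℝ V} (hL : IsRationalSubspace Λ L)
    {g : V →ₗ[ℝ] ℝ} (hg : IsIntegerValued Λ g) : IsRationalSubspace Λ (L ⊓ LinearMap.ker g) := by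
  refine le_antisymm (Submodule.span_le.2 fun x hx => hx.2) ?_
  by_cases h : ∃ v ∈ L, g v ≠ 0
  · obtain ⟨w, hw, hne⟩ := hL.exists_apply_ne_zero h
    -- The projection to ker g along w. Since g is integral, it sends lattice vectors of L to real
    -- multiples of lattice vectors of L ⊓ ker g.
    let P : V →ₗ[ℝ] V := LinearMap.id - (g.smulRight ((g w)⁻¹ • w))
    have hP : ∀ v, P v = v - g v • (g w)⁻¹ • w := fun v => rfl
    intro x hx
    have hPx : P x = x := by rw [hP, LinearMap.mem_ker.1 hx.2, zero_smul, sub_zero]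
    have hxL : x ∈ L := hx.1
    rw [← hL] at hxL
    rw [← hPx]
    refine (Submodule.map_span_le P _ _).2 ?_ (Submodule.mem_map_of_mem hxL)
    intro v hv
    obtain ⟨a, ha⟩ := hg w hw.1
    obtain ⟨n, hn⟩ := hg v hv.1
    have e : P v = (g w)⁻¹ • (a • v - n • w) := by
      rw [hP, ← Int.cast_smul_eq_zsmul ℝ a, ← Int.cast_smul_eq_zsmul ℝ n, ← ha, ← hn, smul_sub,
        inv_smul_smul₀ hne, smul_comm]
    rw [e]
    refine Submodule.smul_mem _ _ (Submodule.subset_span ⟨?_, ?_⟩)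
    · exact sub_mem (Λ.smul_mem _ hv.1) (Λ.smul_mem _ hw.1)
    · have h1 : a • v - n • w ∈ L := sub_mem (zsmul_mem hv.2 _) (zsmul_mem hw.2 _)
      exact ⟨h1, by simp [ha, hn, mul_comm]⟩
  · push Not at h
    have : L ⊓ LinearMap.ker g = L := inf_eq_left.2 h
    rw [this]
    exact hL.ge

/-- Any v ∈ Λ_σ with g v = c works: modulo V_τ it is a positive multiple of a point of σ, and
subtracting a multiple of v moves any vector of Λ_σ into ker g. -/
theorem exists_isPrimitiveVector {σ τ : PointedCone ℝ V} {g : V →ₗ[ℝ] ℝ} {c : ℤ}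
    (hg : IsGenerator g (coneLattice Λ σ) c) (hτ : coneSpan τ = coneSpan σ ⊓ LinearMap.ker g)
    (hpos : ∀ s ∈ σ, 0 ≤ g s) : ∃ v, IsPrimitiveVector Λ σ τ v := by
  obtain ⟨v, hv, hvc⟩ := hg.exists_eq
  have hc : (0 : ℝ) < c := Int.cast_pos.2 hg.pos
  obtain ⟨s, hs, hs0⟩ : ∃ s ∈ σ, 0 < g s := by
    by_contra! hcon
    have : coneSpan σ ≤ LinearMap.ker g :=
      coneSpan_le.2 fun s hs => le_antisymm (hcon s hs) (hpos s hs)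
    have := this hv.2
    rw [LinearMap.mem_ker, hvc] at this
    exact hc.ne' this
  refine ⟨v, hv.1, ⟨(g v / g s) • s, σ.smul_mem ?_ hs, v - (g v / g s) • s, ?_, by abel⟩, ?_⟩
  · rw [hvc]; positivity
  · rw [hτ]
    refine ⟨sub_mem hv.2 (Submodule.smul_mem _ _ (le_coneSpan hs)), ?_⟩
    change g _ = 0
    rw [map_sub, map_smul, smul_eq_mul, div_mul_cancel₀ _ hs0.ne', sub_self]
  · refine le_antisymm (sup_le ?_ (latticeIn_mono (hτ.le.trans inf_le_left))) fun u hu => ?_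
    · rw [Submodule.span_singleton_le_iff_mem]
      exact hv
    · obtain ⟨n, hn⟩ := hg.exists_eq_mul u hu
      rw [Submodule.mem_sup]
      refine ⟨n • v, Submodule.smul_mem _ _ (Submodule.mem_span_singleton_self v), u - n • v, ?_,
        by abel⟩
      have h1 := sub_mem hu (zsmul_mem hv n)
      refine ⟨h1.1, ?_⟩
      change u - n • v ∈ coneSpan τ
      rw [hτ]
      exact ⟨h1.2, by simp [hn, hvc]⟩

theorem IsPrimitiveVector.mem_coneSpan {σ τ : PointedCone ℝ V} {v : V}
    (h : IsPrimitiveVector Λ σ τ v) : v ∈ coneSpan σ := by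
  have : v ∈ coneLattice Λ σ :=
    h.2.2 ▸ Submodule.mem_sup_left (Submodule.mem_span_singleton_self v)
  exact this.2

/-- As g kills Λ_τ, the equation ℤ v + Λ_τ = Λ_σ forces g v = ±c; pointing towards σ fixes the sign.
This evaluates g on an arbitrarily chosen primitive vector. -/
theorem IsPrimitiveVector.apply_eq {σ τ : PointedCone ℝ V} {g : V →ₗ[ℝ] ℝ} {c : ℤ} {v : V}
    (h : IsPrimitiveVector Λ σ τ v) (hg : IsGenerator g (coneLattice Λ σ) c)
    (hτ : coneSpan τ ≤ LinearMap.ker g) (hpos : ∀ s ∈ σ, 0 ≤ g s) : g v = c := by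
  have hc := hg.pos
  have hv : v ∈ coneLattice Λ σ :=
    h.2.2 ▸ Submodule.mem_sup_left (Submodule.mem_span_singleton_self v)
  obtain ⟨n, hn⟩ := hg.exists_eq_mul v hv
  obtain ⟨w, hw, hwc⟩ := hg.exists_eq
  rw [← h.2.2, Submodule.mem_sup] at hw
  obtain ⟨y, hy, z, hz, rfl⟩ := hw
  obtain ⟨k, rfl⟩ := Submodule.mem_span_singleton.1 hy
  have hz0 : g z = 0 := hτ hz.2
  have h0 : 0 ≤ g v := by
    obtain ⟨s, hs, t, ht, rfl⟩ := h.2.1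
    have : g t = 0 := hτ ht
    rw [map_add, this, add_zero]
    exact hpos s hs
  rw [map_add, hz0, add_zero, map_zsmul, hn, zsmul_eq_mul] at hwc
  have e : k * (n * c) = c := by exact_mod_cast hwc
  have hn0 : 0 ≤ n * c := by rw [hn] at h0; exact_mod_cast h0
  have hkn : k * n = 1 := by
    have : (k * n) * c = 1 * c := by linarith
    exact mul_right_cancel₀ hc.ne' this
  have hn1 : n = 1 := by
    rcases Int.eq_one_or_neg_one_of_mul_eq_one' hkn with h | h
    · exact h.2
    · rw [h.2] at hn0; omega
  rw [hn, hn1, Int.cast_one, one_mul]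

theorem isPrimitiveVector_primitiveVector {σ τ : PointedCone ℝ V}
    (h : ∃ v, IsPrimitiveVector Λ σ τ v) :
    IsPrimitiveVector Λ σ τ (primitiveVector Λ σ τ) :=
  Classical.epsilon_spec h

/-- The lattice `Λ` has integer coordinates in some basis. -/
def HasIntegralBasis (Λ : Submodule ℤ V) : Prop :=
  ∃ (n : ℕ) (b : Module.Basis (Fin n) ℝ V), ∀ i, IsIntegerValued Λ (b.coord i)

/-- A lattice vector outside a rational subspace is separated from it by an integral form. -/
theorem HasIntegralBasis.exists_isIntegerValued (hΛ : HasIntegralBasis Λ) {L : Submodule ℝ V}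
    (hL : IsRationalSubspace Λ L) {w : V} (hw : w ∈ Λ) (hwL : w ∉ L) :
    ∃ g : V →ₗ[ℝ] ℝ, IsIntegerValued Λ g ∧ g w ≠ 0 ∧ L ≤ LinearMap.ker g := by
  obtain ⟨n, b, hb⟩ := hΛ
  -- The separation is done over ℚ, against the rational points U of L. Multiplying by the product D
  -- of the denominators makes the functional integral, and rationality of L extends its vanishing
  -- from U to L.
  let toV : (Fin n → ℚ) → V := fun q => ∑ i, (q i : ℝ) • b i
  let U : Submodule ℚ (Fin n → ℚ) :=
    { carrier := {q | toV q ∈ L}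
      add_mem' := by
        intro p q hp hq
        have : toV (p + q) = toV p + toV q := by
          simp [toV, add_smul, Finset.sum_add_distrib]
        rw [Set.mem_ofPred_eq, this]
        exact L.add_mem hp hq
      zero_mem' := by
        have : toV 0 = 0 := by simp [toV]
        rw [Set.mem_ofPred_eq, this]
        exact L.zero_mem
      smul_mem' := by
        intro c q hq
        have : toV (c • q) = (c : ℝ) • toV q := by
          simp [toV, Finset.smul_sum, smul_smul]
        rw [Set.mem_ofPred_eq, this]
        exact L.smul_mem _ hq }
  have hcoord : ∀ v ∈ Λ, ∃ k : Fin n → ℤ, v = toV fun i => k i := by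
    intro v hv
    choose k hk using fun i => hb i v hv
    refine ⟨k, ?_⟩
    conv_lhs => rw [← b.sum_repr v]
    refine Finset.sum_congr rfl fun i _ => ?_
    rw [← Module.Basis.coord_apply, hk, Rat.cast_intCast]
  obtain ⟨k₀, hk₀⟩ := hcoord w hw
  have hk₀U : (fun i => (k₀ i : ℚ)) ∉ U := fun h => hwL (hk₀ ▸ h)
  obtain ⟨f, hf0, hfU⟩ := Submodule.exists_le_ker_of_notMem hk₀U
  let D : ℕ := ∏ i, (f (Pi.single i 1)).den
  have hD : D ≠ 0 := Finset.prod_ne_zero_iff.2 fun i _ => Rat.den_nz _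
  have hDf : ∀ i, ∃ m : ℤ, (D : ℚ) * f (Pi.single i 1) = m := by
    intro i
    obtain ⟨e, he⟩ := Finset.dvd_prod_of_mem (fun i => (f (Pi.single i 1)).den) (Finset.mem_univ i)
    refine ⟨e * (f (Pi.single i 1)).num, ?_⟩
    have : D = (f (Pi.single i 1)).den * e := he
    rw [this]
    push_cast
    conv_lhs => rw [mul_comm ((f (Pi.single i 1)).den : ℚ), mul_assoc, Rat.den_mul_eq_num]
  choose m hm using hDf
  let g : V →ₗ[ℝ] ℝ := b.constr ℝ fun i => (m i : ℝ)
  have hg : ∀ q, g (toV q) = ((D * f q : ℚ) : ℝ) := by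
    intro q
    have e : q = ∑ i, q i • (Pi.single i 1 : Fin n → ℚ) := by
      ext j; simp [Finset.sum_apply, Pi.single_apply]
    have e2 : (D : ℚ) * f q = ∑ i, q i * m i := by
      conv_lhs => rw [e]
      rw [map_sum, Finset.mul_sum]
      refine Finset.sum_congr rfl fun i _ => ?_
      rw [map_smul, smul_eq_mul, ← hm]
      ring
    rw [e2]
    simp [toV, g]
  refine ⟨g, fun v hv => ?_, ?_, ?_⟩
  · obtain ⟨k, rfl⟩ := hcoord v hv
    refine ⟨∑ i, k i * m i, ?_⟩
    simp [toV, g]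
  · rw [hk₀, hg]
    exact_mod_cast mul_ne_zero (Nat.cast_ne_zero.2 hD) hf0
  · rw [← hL]
    refine Submodule.span_le.2 fun v hv => ?_
    obtain ⟨k, rfl⟩ := hcoord v hv.1
    have : (fun i => (k i : ℚ)) ∈ U := hv.2
    have h0 : f (fun i => (k i : ℚ)) = 0 := hfU this
    change g _ = 0
    rw [hg, h0, mul_zero, Rat.cast_zero]

/-- Primitive vectors exist for all faces of codimension one. -/
theorem HasIntegralBasis.exists_isPrimitiveVector [FiniteDimensional ℝ V]
    (hΛ : HasIntegralBasis Λ) {σ τ : PointedCone ℝ V} (hσ : IsRationalPolyhedral Λ σ)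
    (hτ : IsRationalPolyhedral Λ τ) (hface : τ.IsFaceOf σ) (hdim : coneDim τ + 1 = coneDim σ) :
    ∃ v, IsPrimitiveVector Λ σ τ v := by
  have hne : ∃ v ∈ coneSpan σ, v ∉ coneSpan τ := by
    by_contra! hcon
    have := Submodule.finrank_mono (show coneSpan σ ≤ coneSpan τ from hcon)
    simp only [coneDim] at hdim
    omega
  obtain ⟨w, hw, hwτ⟩ := hσ.isRationalSubspace.exists_mem_notMem hne
  obtain ⟨g, hg, hgw, hker⟩ := hΛ.exists_isIntegerValued hτ.isRationalSubspace hw.1 hwτ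
  obtain ⟨c, hc⟩ := IsIntegerValued.exists_isGenerator (M := coneLattice Λ σ)
    (fun v hv => hg v hv.1) ⟨w, hw, hgw⟩
  have hspan : coneSpan τ = coneSpan σ ⊓ LinearMap.ker g := by
    refine Submodule.eq_of_le_of_finrank_eq (le_inf (coneSpan_mono hface.le) hker) ?_
    have := finrank_inf_ker_add_one ⟨w, hw.2, hgw⟩
    simp only [coneDim] at hdim
    omega
  by_cases hpos : ∀ s ∈ σ, 0 ≤ g s
  · exact FanCycle.exists_isPrimitiveVector hc hspan hpos
  · push Not at hpos
    obtain ⟨s, hs, hs0⟩ := hpos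
    refine FanCycle.exists_isPrimitiveVector hc.neg (by rw [hspan]; ext; simp) fun s' hs' => ?_
    by_contra! hcon
    replace hcon : 0 < g s' := by simpa using hcon
    -- If g took both signs on σ, this positive combination would lie in V_τ; since τ is a face, s
    -- would be in τ, where g vanishes.
    have hmem : g s' • s + (-g s) • s' ∈ coneSpan τ := by
      rw [hspan]
      refine ⟨add_mem (Submodule.smul_mem _ _ (le_coneSpan hs))
        (Submodule.smul_mem _ _ (le_coneSpan hs')), ?_⟩
      simp
      ring
    obtain ⟨a, ha, b, hb, e⟩ := exists_sub_of_mem_coneSpan hmem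
    have h1 : s ∈ τ := by
      refine hface.mem_of_smul_add_mem hs (y := (-g s) • s' + b) (add_mem (σ.smul_mem (by linarith) hs')
        (hface.le hb)) hcon ?_
      rw [← add_assoc, e, sub_add_cancel]
      exact ha
    have h2 : g s = 0 := hker (le_coneSpan h1)
    exact hs0.ne h2

section

/-! ### The divisor of the maximum of two linear forms on a subspace -/

/-- Elements of the span are differences of elements of σ, so the choice made in `linearPart` does
not matter there. -/
theorem linearPart_apply {φ : V → ℝ} {σ : PointedCone ℝ V} {l : V →ₗ[ℝ] ℝ}
    (h : ∀ z ∈ σ, φ z = l z) {v : V} (hv : v ∈ coneSpan σ) : linearPart φ σ v = l v := by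
  have hspec : ∀ z ∈ σ, φ z = linearPart φ σ z :=
    Classical.epsilon_spec (p := fun l : V →ₗ[ℝ] ℝ => ∀ x ∈ σ, φ x = l x) ⟨l, h⟩
  obtain ⟨a, ha, b, hb, rfl⟩ := exists_sub_of_mem_coneSpan hv
  rw [map_sub, map_sub, ← hspec a ha, ← hspec b hb, h a ha, h b hb]

/-- If `max x y` is linear on a cone, the cone lies on one side of `x = y`. -/
theorem nonneg_or_nonpos_of_isRationalFunction {x y : V →ₗ[ℝ] ℝ} {X : TropicalFan Λ}
    (hφ : IsRationalFunction (fun v => max (x v) (y v)) X) {σ : PointedCone ℝ V}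
    (hσ : σ ∈ X.cones) : (∀ s ∈ σ, 0 ≤ (x - y) s) ∨ ∀ s ∈ σ, 0 ≤ (y - x) s := by
  by_contra! hcon
  obtain ⟨⟨p, hp, hp0⟩, q, hq, hq0⟩ := hcon
  obtain ⟨l, hl, -⟩ := hφ σ hσ
  rw [LinearMap.sub_apply] at hp0 hq0
  have h1 : max (x p) (y p) = l p := hl p hp
  have h2 : max (x q) (y q) = l q := hl q hq
  have h3 := hl (p + q) (add_mem hp hq)
  simp only [map_add] at h3
  rw [max_eq_right (by linarith)] at h1
  rw [max_eq_left (by linarith)] at h2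
  rw [← h1, ← h2] at h3
  rcases max_choice (x p + x q) (y p + y q) with h | h <;> linarith

theorem mem_conesAround {C : Finset (PointedCone ℝ V)} {d : ℕ} {τ σ : PointedCone ℝ V} :
    σ ∈ conesAround C d τ ↔ σ ∈ C ∧ coneDim σ = d ∧ τ ≤ σ := by
  simp [conesAround]

variable [FiniteDimensional ℝ V]

namespace RepresentsSubspace

variable {X : TropicalFan Λ} {L : Submodule ℝ V} {m : ℤ}

/-- From any point of a cone inside the subspace, each direction enters a facet around the cone. -/
theorem exists_facet_in_direction (h : RepresentsSubspace X L m) {τ : PointedCone ℝ V}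
    (hτ : τ ∈ X.cones) (hτL : coneSpan τ ≤ L) {v : V} (hv : v ∈ L) :
    ∃ σ, IsWeightedFacet X σ ∧ τ ≤ σ ∧ ∃ p ∈ coneSpan τ, ∃ ε > (0 : ℝ), p + ε • v ∈ σ := by
  classical
  obtain ⟨p, hp, hint⟩ := (X.rational τ hτ).exists_relint
  obtain ⟨σ, hσ, hpσ, ε, hε, hmem⟩ := exists_mem_and_add_smul_mem (Λ := Λ) (x := p) (p := v)
    (X.cones.filter fun σ => IsWeightedFacet X σ)
    (fun σ hσ => X.rational σ (Finset.mem_filter.1 hσ).1) (fun ε _ => by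
      obtain ⟨σ, hσ, hmem⟩ := h.exists_isWeightedFacet
        (L.add_mem (hτL (le_coneSpan hp)) (L.smul_mem ε hv))
      exact ⟨σ, Finset.mem_filter.2 ⟨hσ.1, hσ⟩, hmem⟩)
  obtain ⟨hσX, hσ⟩ := Finset.mem_filter.1 hσ
  refine ⟨σ, hσ, ?_, p, le_coneSpan hp, ε, hε, hmem⟩
  -- τ ⊓ σ is a face of τ through a relative interior point, hence all of τ.
  have := eq_of_isFaceOf_of_relint_mem (X.inter_face τ hτ σ hσX) hint ⟨hp, hpσ⟩
  exact inf_eq_left.1 this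

/-- There is at most one facet around a ridge on each side of it. -/
theorem facet_unique (h : RepresentsSubspace X L m) {τ σ σ' : PointedCone ℝ V}
    (hτ : τ ∈ X.cones) (hσ : IsWeightedFacet X σ) (hσ' : IsWeightedFacet X σ') (hle : τ ≤ σ)
    (hle' : τ ≤ σ') {g : V →ₗ[ℝ] ℝ} (hg : ∃ v ∈ L, g v ≠ 0)
    (hspan : coneSpan τ = L ⊓ LinearMap.ker g)
    (hpos : ∀ s ∈ σ, 0 ≤ g s) (hpos' : ∀ s ∈ σ', 0 ≤ g s) : σ = σ' := by
  have key : ∀ ρ, IsWeightedFacet X ρ → (∀ s ∈ ρ, 0 ≤ g s) → ∃ s ∈ ρ, 0 < g s := by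
    intro ρ hρ hnn
    by_contra! hcon
    obtain ⟨v, hv, hne⟩ := hg
    rw [← h.coneSpan_eq hρ] at hv
    exact hne ((coneSpan_le (L := LinearMap.ker g)).2
      (fun s hs => le_antisymm (hcon s hs) (hnn s hs)) hv)
  obtain ⟨s, hs, hs0⟩ := key σ hσ hpos
  obtain ⟨s', hs', hs0'⟩ := key σ' hσ' hpos'
  obtain ⟨p, hp, hint⟩ := (X.rational τ hτ).exists_relint
  have ht : (g s / g s') • s' - s ∈ coneSpan τ := by
    rw [hspan]
    refine ⟨sub_mem (Submodule.smul_mem _ _ (h.mem_of_isWeightedFacet hσ' hs'))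
      (h.mem_of_isWeightedFacet hσ hs), ?_⟩
    change g _ = 0
    rw [map_sub, map_smul, smul_eq_mul, div_mul_cancel₀ _ hs0'.ne', sub_self]
  obtain ⟨ε, hε, hmem⟩ := hint _ ht
  -- A common point of both facets off the hyperplane: rescaled, s' agrees with s modulo V_τ, and
  -- the relative interior point p absorbs the difference. Together with τ it spans L.
  let w := p + (ε * (g s / g s')) • s'
  have hw : w ∈ σ ⊓ σ' := by
    constructor
    · have : w = p + ε • ((g s / g s') • s' - s) + ε • s := by
        simp only [w]
        module
      rw [this]
      exact add_mem (hle hmem) (σ.smul_mem hε.le hs)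
    · exact add_mem (hle' hp) (σ'.smul_mem (by positivity) hs')
  have hgw : g w ≠ 0 := by
    have hp0 : g p = 0 := by
      have := le_coneSpan hp
      rw [hspan] at this
      exact this.2
    simp only [w, map_add, map_smul, hp0, zero_add, smul_eq_mul]
    positivity
  have hLle : L ≤ coneSpan (σ ⊓ σ') := by
    intro u hu
    have h1 : u - (g u / g w) • w ∈ coneSpan τ := by
      rw [hspan]
      refine ⟨sub_mem hu (Submodule.smul_mem _ _ (h.mem_of_isWeightedFacet hσ hw.1)), ?_⟩
      change g _ = 0
      rw [map_sub, map_smul, smul_eq_mul, div_mul_cancel₀ _ hgw, sub_self]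
    have h2 := add_mem (coneSpan_mono (le_inf hle hle') h1)
      (Submodule.smul_mem _ (g u / g w) (le_coneSpan hw))
    rwa [sub_add_cancel] at h2
  exact X.eq_of_coneSpan_le_inf hσ.1 hσ'.1 ((h.coneSpan_eq hσ).le.trans hLle)
    ((h.coneSpan_eq hσ').le.trans hLle)

variable {x y : V →ₗ[ℝ] ℝ}

theorem coneSpan_ridge_eq (h : RepresentsSubspace X L m) {g : V →ₗ[ℝ] ℝ}
    (hg : ∃ v ∈ L, g v ≠ 0) {τ : PointedCone ℝ V} (hdim : coneDim τ + 1 = X.dim)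
    (hτ : ∀ t ∈ τ, t ∈ L ⊓ LinearMap.ker g) : coneSpan τ = L ⊓ LinearMap.ker g := by
  refine Submodule.eq_of_le_of_finrank_eq (coneSpan_le.2 hτ) ?_
  have := finrank_inf_ker_add_one hg
  rw [← h.dim_eq, ← hdim] at this
  simp only [coneDim] at this
  omega

/-- The weight of a ridge in `x = y`. -/
theorem divisorWeight_of_le (h : RepresentsSubspace X L m)
    (hφ : IsRationalFunction (fun v => max (x v) (y v)) X) {c : ℤ}
    (hc : IsGenerator (x - y) (latticeIn Λ L) c) {τ : PointedCone ℝ V} (hτ : τ ∈ X.cones)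
    (hdim : coneDim τ + 1 = X.dim) (hker : ∀ t ∈ τ, t ∈ L ⊓ LinearMap.ker (x - y)) :
    divisorWeight (fun v => max (x v) (y v)) X τ = m * c := by
  have hcpos : (0 : ℝ) < c := Int.cast_pos.2 hc.pos
  obtain ⟨v₀, hv₀, hv₀c⟩ := hc.exists_eq
  have hg : ∃ v ∈ L, (x - y) v ≠ 0 := ⟨v₀, hv₀.2, by rw [hv₀c]; exact hcpos.ne'⟩
  have hspan := h.coneSpan_ridge_eq hg hdim hker
  have hspan' : coneSpan τ = L ⊓ LinearMap.ker (y - x) := by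
    rw [hspan, ← neg_sub x y]
    ext v
    simp [sub_eq_zero, @eq_comm _ (x v)]
  have hc' : IsGenerator (y - x) (latticeIn Λ L) c := by
    rw [← neg_sub x y]
    exact hc.neg
  have side : ∀ {g : V →ₗ[ℝ] ℝ}, (∃ v ∈ L, g v = c) → coneSpan τ = L ⊓ LinearMap.ker g →
      ∃ σ, IsWeightedFacet X σ ∧ τ ≤ σ ∧ ∃ s ∈ σ, 0 < g s := by
    rintro g ⟨v, hv, hvc⟩ hsp
    obtain ⟨σ, hσ, hle, p, hp, ε, hε, hmem⟩ :=
      h.exists_facet_in_direction hτ (hsp.le.trans inf_le_left) hv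
    rw [hsp] at hp
    have hp0 : g p = 0 := hp.2
    refine ⟨σ, hσ, hle, _, hmem, ?_⟩
    rw [map_add, map_smul, hp0, zero_add, smul_eq_mul, hvc]
    positivity
  obtain ⟨σ, hσ, hle, s, hs, hs0⟩ := side ⟨v₀, hv₀.2, hv₀c⟩ hspan
  obtain ⟨σ', hσ', hle', s', hs', hs0'⟩ := side (g := y - x)
    ⟨-v₀, L.neg_mem hv₀.2, by rw [map_neg, ← neg_sub x y, LinearMap.neg_apply, neg_neg, hv₀c]⟩ hspan'
  have hpos : ∀ s ∈ σ, 0 ≤ (x - y) s :=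
    (nonneg_or_nonpos_of_isRationalFunction hφ hσ.1).resolve_right fun hn => by
      have := hn s hs
      simp only [LinearMap.sub_apply] at this hs0
      linarith
  have hpos' : ∀ s ∈ σ', 0 ≤ (y - x) s :=
    (nonneg_or_nonpos_of_isRationalFunction hφ hσ'.1).resolve_left fun hn => by
      have := hn s' hs'
      simp only [LinearMap.sub_apply] at this hs0'
      linarith
  have hne : σ ≠ σ' := by
    rintro rfl
    have := hpos' s hs
    simp only [LinearMap.sub_apply] at this hs0
    linarith
  have hall : ∀ ρ ∈ conesAround X.cones X.dim τ, ρ ≠ σ ∧ ρ ≠ σ' → X.weight ρ = 0 := by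
    intro ρ hρ hρne
    obtain ⟨hρX, hρd, hρle⟩ := mem_conesAround.1 hρ
    by_contra hw
    have hρw : IsWeightedFacet X ρ := ⟨hρX, hρd, hw⟩
    rcases nonneg_or_nonpos_of_isRationalFunction hφ hρX with hp | hp
    · exact hρne.1 (h.facet_unique hτ hρw hσ hρle hle hg hspan hp hpos)
    · exact hρne.2 (h.facet_unique hτ hρw hσ' hρle hle' ⟨v₀, hv₀.2, by
        rw [← neg_sub x y, LinearMap.neg_apply, hv₀c]; exact neg_ne_zero.2 hcpos.ne'⟩
        hspan' hp hpos')
  have hσA : σ ∈ conesAround X.cones X.dim τ := mem_conesAround.2 ⟨hσ.1, hσ.2.1, hle⟩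
  have hσA' : σ' ∈ conesAround X.cones X.dim τ := mem_conesAround.2 ⟨hσ'.1, hσ'.2.1, hle'⟩
  have hsum := Finset.sum_eq_add (s := conesAround X.cones X.dim τ)
    (f := fun ρ => X.weight ρ • primitiveVector Λ ρ τ) σ σ' hne
    (fun ρ hρ hρne => by rw [hall ρ hρ hρne, zero_smul])
    (fun hn => absurd hσA hn) (fun hn => absurd hσA' hn)
  have hsum' := Finset.sum_eq_add (s := conesAround X.cones X.dim τ)
    (f := fun ρ => (X.weight ρ : ℝ) * linearPart (fun v => max (x v) (y v)) ρ
      (primitiveVector Λ ρ τ)) σ σ' hne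
    (fun ρ hρ hρne => by rw [hall ρ hρ hρne, Int.cast_zero, zero_mul])
    (fun hn => absurd hσA hn) (fun hn => absurd hσA' hn)
  have hbal := X.balanced τ hτ hdim
  rw [hsum] at hbal
  have hgen : IsGenerator (x - y) (coneLattice Λ σ) c := by
    rwa [coneLattice, h.coneSpan_eq hσ]
  have hgen' : IsGenerator (y - x) (coneLattice Λ σ') c := by
    rwa [coneLattice, h.coneSpan_eq hσ']
  have hprim := isPrimitiveVector_primitiveVector
    (FanCycle.exists_isPrimitiveVector (τ := τ) hgen (by rw [h.coneSpan_eq hσ, hspan]) hpos)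
  have hprim' := isPrimitiveVector_primitiveVector
    (FanCycle.exists_isPrimitiveVector (τ := τ) hgen' (by rw [h.coneSpan_eq hσ', hspan']) hpos')
  have hval := hprim'.apply_eq hgen' (hspan'.le.trans inf_le_right) hpos'
  -- With v, v' the two primitive vectors, balancing puts m v + m v' in V_τ, where the function is
  -- x. The weight is m x(v) + m y(v') - x(m v + m v') = m (y - x)(v') = m c.
  rw [divisorWeight, hsum, hsum', linearPart_apply (l := x) _ hprim.mem_coneSpan,
    linearPart_apply (l := y) _ hprim'.mem_coneSpan, linearPart_apply (l := x) _ hbal,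
    h.weight_eq σ hσ, h.weight_eq σ' hσ', map_add, map_zsmul, map_zsmul, zsmul_eq_mul,
    zsmul_eq_mul, ← hval, LinearMap.sub_apply]
  · ring
  · intro t ht
    have : (x - y) t = 0 := (hker t ht).2
    rw [LinearMap.sub_apply, sub_eq_zero] at this
    simp [this]
  · intro t ht
    have := hpos' t ht
    rw [LinearMap.sub_apply] at this
    exact max_eq_right (by linarith)
  · intro t ht
    have := hpos t ht
    rw [LinearMap.sub_apply] at this
    exact max_eq_left (by linarith)

/-- The function is linear around a ridge that is not contained in `x = y`. -/
theorem divisorWeight_of_not_le (hΛ : HasIntegralBasis Λ)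
    (hφ : IsRationalFunction (fun v => max (x v) (y v)) X) {τ : PointedCone ℝ V}
    (hτ : τ ∈ X.cones) (hdim : coneDim τ + 1 = X.dim) (hker : ∃ t ∈ τ, (x - y) t ≠ 0) :
    divisorWeight (fun v => max (x v) (y v)) X τ = 0 := by
  obtain ⟨t, ht, hne⟩ := hker
  -- Every cone around τ contains t and lies on one side of x = y, so it lies on the side of t.
  obtain ⟨l, hl⟩ : ∃ l : V →ₗ[ℝ] ℝ, ∀ σ ∈ X.cones, τ ≤ σ → ∀ z ∈ σ, max (x z) (y z) = l z := by
    rcases lt_or_gt_of_ne hne with hlt | hgt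
    · refine ⟨y, fun σ hσ hle z hz => max_eq_right ?_⟩
      have := ((nonneg_or_nonpos_of_isRationalFunction hφ hσ).resolve_left fun hn =>
        (hn t (hle ht)).not_gt hlt) z hz
      rw [LinearMap.sub_apply] at this
      linarith
    · refine ⟨x, fun σ hσ hle z hz => max_eq_left ?_⟩
      have := ((nonneg_or_nonpos_of_isRationalFunction hφ hσ).resolve_right fun hn => by
        have := hn t (hle ht)
        rw [LinearMap.sub_apply] at this hgt
        linarith) z hz
      rw [LinearMap.sub_apply] at this
      linarith
  rw [divisorWeight, linearPart_apply (hl τ hτ le_rfl) (X.balanced τ hτ hdim), map_sum,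
    sub_eq_zero]
  refine Finset.sum_congr rfl fun σ hσ => ?_
  obtain ⟨hσX, hσd, hle⟩ := mem_conesAround.1 hσ
  -- Without existence, `primitiveVector` would be an arbitrary vector, possibly outside V_σ, where
  -- the linear part is not determined.
  have hprim := isPrimitiveVector_primitiveVector (hΛ.exists_isPrimitiveVector
    (X.rational σ hσX) (X.rational τ hτ) (X.isFaceOf_of_le hτ hσX hle) (hdim.trans hσd.symm))
  rw [linearPart_apply (hl σ hσX hle) hprim.mem_coneSpan, map_zsmul, zsmul_eq_mul]

/-- The divisor of `max x y` on the subspace `L` is the subspace `L ∩ {x = y}`, with multiplicity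
the positive generator of `(x - y)(Λ_L)`. -/
theorem of_isDivisor (hΛ : HasIntegralBasis Λ) (h : RepresentsSubspace X L m) (hm : m ≠ 0)
    {c : ℤ} (hc : IsGenerator (x - y) (latticeIn Λ L) c) {D : TropicalFan Λ}
    (hD : IsDivisor (fun v => max (x v) (y v)) X D) :
    RepresentsSubspace D (L ⊓ LinearMap.ker (x - y)) (m * c) := by
  classical
  obtain ⟨hφ, hDdim, hDcones, hDw⟩ := hD
  have hcpos : (0 : ℝ) < c := Int.cast_pos.2 hc.pos
  obtain ⟨v₀, hv₀, hv₀c⟩ := hc.exists_eq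
  have hg : ∃ v ∈ L, (x - y) v ≠ 0 := ⟨v₀, hv₀.2, by rw [hv₀c]; exact hcpos.ne'⟩
  have hfin := finrank_inf_ker_add_one hg
  have hdimX := h.dim_eq
  have hmc : m * c ≠ 0 := mul_ne_zero hm hc.pos.ne'
  have ridge : ∀ {τ}, τ ∈ X.cones → coneDim τ + 1 = X.dim →
      (∀ t ∈ τ, t ∈ L ⊓ LinearMap.ker (x - y)) → IsWeightedFacet D τ ∧ D.weight τ = m * c := by
    intro τ hτ hdim hker
    have h1 := hDw τ hτ hdim
    rw [h.divisorWeight_of_le hφ hc hτ hdim hker] at h1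
    have h2 : D.weight τ = m * c := by exact_mod_cast h1
    refine ⟨⟨?_, by omega, h2 ▸ hmc⟩, h2⟩
    rw [hDcones]
    exact Finset.mem_filter.2 ⟨hτ, by omega⟩
  have facet : ∀ {τ}, IsWeightedFacet D τ → τ ∈ X.cones ∧ coneDim τ + 1 = X.dim ∧
      ∀ t ∈ τ, t ∈ L ⊓ LinearMap.ker (x - y) := by
    rintro τ ⟨hτD, hd, hw⟩
    rw [hDcones] at hτD
    obtain ⟨hτ, -⟩ := Finset.mem_filter.1 hτD
    -- The truncated subtraction in the dimension of D is harmless: g is nonzero on L, so X has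
    -- positive dimension.
    have hdim : coneDim τ + 1 = X.dim := by omega
    have h1 := hDw τ hτ hdim
    have hker : ∀ t ∈ τ, (x - y) t = 0 := by
      by_contra! hcon
      rw [divisorWeight_of_not_le hΛ hφ hτ hdim hcon] at h1
      exact hw (by exact_mod_cast h1)
    refine ⟨hτ, hdim, fun t ht => ⟨?_, hker t ht⟩⟩
    by_contra htL
    -- X may have facets of weight zero outside L; ridges not contained in L lie only in such
    -- facets.
    have hzero : ∀ σ ∈ conesAround X.cones X.dim τ, X.weight σ = 0 := by
      intro σ hσ
      obtain ⟨hσX, hσd, hle⟩ := mem_conesAround.1 hσ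
      by_contra hne
      exact htL (h.mem_of_isWeightedFacet ⟨hσX, hσd, hne⟩ (hle ht))
    rw [divisorWeight, Finset.sum_eq_zero (fun σ hσ => by rw [hzero σ hσ, Int.cast_zero, zero_mul]),
      Finset.sum_eq_zero (fun σ hσ => by rw [hzero σ hσ, zero_smul]), map_zero, sub_zero] at h1
    exact hw (by exact_mod_cast h1)
  refine ⟨by omega, ?_, fun σ hσ => ?_⟩
  · ext z
    constructor
    · rintro ⟨τ, hτ, hz⟩
      exact (facet hτ).2.2 z hz
    · intro hz
      set K := L ⊓ LinearMap.ker (x - y) with hK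
      -- A generic direction p in K: a facet σ containing z and some z + ε p meets K in a cone
      -- spanning K. As σ lies on one side of the hyperplane, σ ⊓ K is a face, hence a ridge of X
      -- through z.
      obtain ⟨p, hp, hnot⟩ := exists_mem_forall_notMem (PointedCone.ofSubmodule K)
        ((X.cones.image fun σ => coneSpan (σ ⊓ PointedCone.ofSubmodule K)).filter
          fun q => ∃ x ∈ PointedCone.ofSubmodule K, x ∉ q)
        (fun q hq => (Finset.mem_filter.1 hq).2)
      obtain ⟨σ, hσ, hzσ, ε, hε, hmem⟩ := exists_mem_and_add_smul_mem (Λ := Λ) (x := z) (p := p)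
        (X.cones.filter fun σ => IsWeightedFacet X σ)
        (fun σ hσ => X.rational σ (Finset.mem_filter.1 hσ).1) (fun ε _ => by
          obtain ⟨σ, hσ, hmem⟩ := h.exists_isWeightedFacet (L.add_mem hz.1 (L.smul_mem ε hp.1))
          exact ⟨σ, Finset.mem_filter.2 ⟨hσ.1, hσ⟩, hmem⟩)
      obtain ⟨hσX, hσ⟩ := Finset.mem_filter.1 hσ
      set F := σ ⊓ PointedCone.ofSubmodule K with hF
      have hpF : p ∈ coneSpan F := by
        have h1 : z ∈ coneSpan F := le_coneSpan ⟨hzσ, hz⟩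
        have h2 : z + ε • p ∈ coneSpan F :=
          le_coneSpan ⟨hmem, K.add_mem hz (K.smul_mem ε hp)⟩
        have h3 := sub_mem h2 h1
        rw [add_sub_cancel_left] at h3
        exact ((coneSpan F).smul_mem_iff hε.ne').1 h3
      have hspan : coneSpan F = K := by
        refine le_antisymm (coneSpan_le.2 fun w hw => hw.2) ?_
        by_contra hcon
        rw [SetLike.not_le_iff_exists] at hcon
        exact hnot _ (Finset.mem_filter.2 ⟨Finset.mem_image_of_mem _ hσX, hcon⟩) hpF
      have hface : F.IsFaceOf σ := by
        refine .of_mem_of_add_mem_left inf_le_left fun {a b} ha hb hab => ⟨ha, ?_⟩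
        refine ⟨h.mem_of_isWeightedFacet hσ ha, ?_⟩
        have h0 : (x - y) (a + b) = 0 := hab.2.2
        change (x - y) a = 0
        simp only [LinearMap.sub_apply, map_add] at h0 ⊢
        rcases nonneg_or_nonpos_of_isRationalFunction hφ hσX with hs | hs
        all_goals
          have ha' := hs a ha
          have hb' := hs b hb
          simp only [LinearMap.sub_apply] at ha' hb'
          linarith
      exact ⟨F, (ridge (X.face_mem σ hσX F hface) (by rw [coneDim, hspan]; omega)
        fun t ht => ht.2).1, hzσ, hz⟩
  · obtain ⟨h1, h2, h3⟩ := facet hσ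
    exact (ridge h1 h2 h3).2

end RepresentsSubspace

end

section

/-! ### Subdividing a subspace by a hyperplane -/

/-- The half of the subspace `L` on which `g` is non-negative. -/
def halfSpace (L : Submodule ℝ V) (g : V →ₗ[ℝ] ℝ) : PointedCone ℝ V :=
  PointedCone.ofSubmodule L ⊓ (PointedCone.positive ℝ ℝ).comap g

theorem mem_halfSpace {L : Submodule ℝ V} {g : V →ₗ[ℝ] ℝ} {v : V} :
    v ∈ halfSpace L g ↔ v ∈ L ∧ 0 ≤ g v :=
  Iff.rfl

theorem inf_ker_neg (L : Submodule ℝ V) (g : V →ₗ[ℝ] ℝ) :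
    L ⊓ LinearMap.ker (-g) = L ⊓ LinearMap.ker g := by
  ext; simp

theorem ofSubmodule_inf_ker_le_halfSpace (L : Submodule ℝ V) (g : V →ₗ[ℝ] ℝ) :
    PointedCone.ofSubmodule (L ⊓ LinearMap.ker g) ≤ halfSpace L g :=
  fun _ hv => ⟨hv.1, (LinearMap.mem_ker.1 hv.2).ge⟩

theorem halfSpace_inf_halfSpace_neg (L : Submodule ℝ V) (g : V →ₗ[ℝ] ℝ) :
    halfSpace L g ⊓ halfSpace L (-g) = PointedCone.ofSubmodule (L ⊓ LinearMap.ker g) := by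
  ext v
  constructor
  · rintro ⟨h1, h2⟩
    refine ⟨h1.1, le_antisymm ?_ h1.2⟩
    simpa using (mem_halfSpace.1 h2).2
  · rintro ⟨h1, h2⟩
    have h2 : g v = 0 := h2
    exact ⟨⟨h1, h2.ge⟩, mem_halfSpace.2 ⟨h1, by simp [h2]⟩⟩

theorem isFaceOf_halfSpace (L : Submodule ℝ V) (g : V →ₗ[ℝ] ℝ) :
    (PointedCone.ofSubmodule (L ⊓ LinearMap.ker g)).IsFaceOf (halfSpace L g) := by
  refine .of_mem_of_add_mem_left (ofSubmodule_inf_ker_le_halfSpace L g)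
    fun {a b} ha hb hab => ⟨ha.1, ?_⟩
  have h0 : g (a + b) = 0 := hab.2
  have ha' := (mem_halfSpace.1 ha).2
  have hb' := (mem_halfSpace.1 hb).2
  rw [map_add] at h0
  change g a = 0
  linarith

/-- If g p > 0 for some p in the face, then p - ε v stays in the half-space for small ε > 0, so
every v belongs to the face. Otherwise the face lies in L ⊓ ker g, all of which belongs to every
face. -/
theorem eq_or_eq_of_isFaceOf_halfSpace {L : Submodule ℝ V} {g : V →ₗ[ℝ] ℝ} {F : PointedCone ℝ V}
    (hF : F.IsFaceOf (halfSpace L g)) :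
    F = halfSpace L g ∨ F = PointedCone.ofSubmodule (L ⊓ LinearMap.ker g) := by
  by_cases h : ∃ p ∈ F, 0 < g p
  · obtain ⟨p, hp, hp0⟩ := h
    refine Or.inl (le_antisymm hF.le fun v hv => ?_)
    have hpH := mem_halfSpace.1 (hF.le hp)
    have hvH := mem_halfSpace.1 hv
    have hε : 0 < g p / (g v + 1) := div_pos hp0 (by linarith)
    refine hF.mem_of_smul_add_mem hv (y := p - (g p / (g v + 1)) • v) ?_ hε
      (by rwa [add_sub_cancel])
    refine ⟨L.sub_mem hpH.1 (L.smul_mem _ hvH.1), ?_⟩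
    change 0 ≤ g _
    have h1 : g v + 1 ≠ 0 := by linarith
    have : g (p - (g p / (g v + 1)) • v) = g p / (g v + 1) := by
      rw [map_sub, map_smul, smul_eq_mul]
      field_simp
      ring
    rw [this]
    exact hε.le
  · push Not at h
    refine Or.inr (le_antisymm (fun v hv => ?_) fun v hv => ?_)
    · have := mem_halfSpace.1 (hF.le hv)
      exact ⟨this.1, le_antisymm (h v hv) this.2⟩
    · refine hF.mem_of_add_mem_left (y := -v) (ofSubmodule_inf_ker_le_halfSpace L g hv)
        (ofSubmodule_inf_ker_le_halfSpace L g ((L ⊓ LinearMap.ker g).neg_mem hv)) ?_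
      rw [add_neg_cancel]
      exact zero_mem _

theorem coneSpan_halfSpace {L : Submodule ℝ V} {g : V →ₗ[ℝ] ℝ} (hg : ∃ v ∈ L, 0 < g v) :
    coneSpan (halfSpace L g) = L := by
  refine le_antisymm (coneSpan_le.2 fun v hv => hv.1) fun u hu => ?_
  obtain ⟨v, hv, hv0⟩ := hg
  have h1 : u - (g u / g v) • v ∈ halfSpace L g := by
    refine ⟨L.sub_mem hu (L.smul_mem _ hv), ?_⟩
    change 0 ≤ g _
    rw [map_sub, map_smul, smul_eq_mul, div_mul_cancel₀ _ hv0.ne', sub_self]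
  have h2 : v ∈ halfSpace L g := ⟨hv, hv0.le⟩
  have h3 := add_mem (le_coneSpan h1) (Submodule.smul_mem _ (g u / g v) (le_coneSpan h2))
  rwa [sub_add_cancel] at h3

theorem exists_pos_of_isGenerator {L : Submodule ℝ V} {g : V →ₗ[ℝ] ℝ} {c : ℤ}
    (hc : IsGenerator g (latticeIn Λ L) c) : ∃ v ∈ L, 0 < g v := by
  obtain ⟨v, hv, e⟩ := hc.exists_eq
  exact ⟨v, hv.2, by rw [e]; exact Int.cast_pos.2 hc.pos⟩

theorem coneDim_halfSpace {L : Submodule ℝ V} {g : V →ₗ[ℝ] ℝ} (hg : ∃ v ∈ L, 0 < g v) :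
    coneDim (halfSpace L g) = Module.finrank ℝ L := by
  rw [coneDim, coneSpan_halfSpace hg]

theorem coneDim_ofSubmodule (L : Submodule ℝ V) :
    coneDim (PointedCone.ofSubmodule L) = Module.finrank ℝ L := by
  rw [coneDim, coneSpan_ofSubmodule]

theorem halfSpace_ne_halfSpace_neg {L : Submodule ℝ V} {g : V →ₗ[ℝ] ℝ}
    (hg : ∃ v ∈ L, 0 < g v) : halfSpace L g ≠ halfSpace L (-g) := by
  obtain ⟨v, hv, hv0⟩ := hg
  intro e
  have : v ∈ halfSpace L (-g) := e ▸ (⟨hv, hv0.le⟩ : v ∈ halfSpace L g)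
  have := (mem_halfSpace.1 this).2
  rw [LinearMap.neg_apply] at this
  linarith

open Classical in
/-- The cones of the subdivision of `L` by the hyperplane `g = 0`. -/
def splitCones (L : Submodule ℝ V) (g : V →ₗ[ℝ] ℝ) : Finset (PointedCone ℝ V) :=
  {halfSpace L g, halfSpace L (-g), PointedCone.ofSubmodule (L ⊓ LinearMap.ker g)}

theorem mem_splitCones {L : Submodule ℝ V} {g : V →ₗ[ℝ] ℝ} {σ : PointedCone ℝ V} :
    σ ∈ splitCones L g ↔ σ = halfSpace L g ∨ σ = halfSpace L (-g) ∨
      σ = PointedCone.ofSubmodule (L ⊓ LinearMap.ker g) := by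
  simp [splitCones]

variable [FiniteDimensional ℝ V]

theorem isRationalPolyhedral_halfSpace {L : Submodule ℝ V} {g : V →ₗ[ℝ] ℝ} {c : ℤ}
    (hc : IsGenerator g (latticeIn Λ L) c)
    (hK : IsRationalSubspace Λ (L ⊓ LinearMap.ker g)) :
    IsRationalPolyhedral Λ (halfSpace L g) := by
  classical
  obtain ⟨S, hS, e⟩ := isRationalPolyhedral_ofSubmodule hK
  obtain ⟨v, hv, hvc⟩ := hc.exists_eq
  have hcpos : (0 : ℝ) < c := Int.cast_pos.2 hc.pos
  have hgv : 0 < g v := hvc ▸ hcpos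
  refine ⟨insert v S, ?_, le_antisymm (fun u hu => ?_) (Submodule.span_le.2 ?_)⟩
  · rw [Finset.coe_insert]
    exact Set.insert_subset hv.1 hS
  · have huH := mem_halfSpace.1 hu
    have h1 : u - (g u / g v) • v ∈ PointedCone.hull ℝ (S : Set V) := by
      rw [← e]
      refine ⟨sub_mem huH.1 (L.smul_mem _ hv.2), ?_⟩
      change g _ = 0
      rw [map_sub, map_smul, smul_eq_mul, div_mul_cancel₀ _ hgv.ne', sub_self]
    have h2 : u - (g u / g v) • v ∈ PointedCone.hull ℝ ((insert v S : Finset V) : Set V) :=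
      Submodule.span_mono (by simp) h1
    have h3 := add_mem h2 (PointedCone.smul_mem _ (div_nonneg huH.2 hgv.le)
      (Submodule.subset_span (by simp) : v ∈ PointedCone.hull ℝ ((insert v S : Finset V) : Set V)))
    rwa [sub_add_cancel] at h3
  · rw [Finset.coe_insert]
    refine Set.insert_subset ⟨hv.2, hgv.le⟩ fun s hs => ?_
    refine ofSubmodule_inf_ker_le_halfSpace L g ?_
    rw [e]
    exact Submodule.subset_span hs

theorem coneDim_inf_ker_add_one {L : Submodule ℝ V} {g : V →ₗ[ℝ] ℝ} (hg : ∃ v ∈ L, 0 < g v) :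
    coneDim (PointedCone.ofSubmodule (L ⊓ LinearMap.ker g)) + 1 = Module.finrank ℝ L := by
  rw [coneDim_ofSubmodule]
  obtain ⟨v, hv, h⟩ := hg
  exact finrank_inf_ker_add_one ⟨v, hv, h.ne'⟩

theorem sum_conesAround_splitCones {M : Type*} [AddCommMonoid M] {L : Submodule ℝ V}
    {g : V →ₗ[ℝ] ℝ} (hg : ∃ v ∈ L, 0 < g v) (f : PointedCone ℝ V → M) :
    ∑ σ ∈ conesAround (splitCones L g) (Module.finrank ℝ L)
      (PointedCone.ofSubmodule (L ⊓ LinearMap.ker g)), f σ =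
      f (halfSpace L g) + f (halfSpace L (-g)) := by
  classical
  have hg' : ∃ v ∈ L, 0 < (-g) v := by
    obtain ⟨v, hv, h⟩ := hg
    exact ⟨-v, neg_mem hv, by simpa using h⟩
  have hdim := coneDim_inf_ker_add_one hg
  have : conesAround (splitCones L g) (Module.finrank ℝ L)
      (PointedCone.ofSubmodule (L ⊓ LinearMap.ker g)) = {halfSpace L g, halfSpace L (-g)} := by
    ext σ
    rw [mem_conesAround, mem_splitCones, Finset.mem_insert, Finset.mem_singleton]
    constructor
    · rintro ⟨rfl | rfl | rfl, hd, -⟩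
      · exact Or.inl rfl
      · exact Or.inr rfl
      · omega
    · rintro (rfl | rfl)
      · exact ⟨Or.inl rfl, coneDim_halfSpace hg, ofSubmodule_inf_ker_le_halfSpace L g⟩
      · refine ⟨Or.inr (Or.inl rfl), coneDim_halfSpace hg', ?_⟩
        rw [← inf_ker_neg]
        exact ofSubmodule_inf_ker_le_halfSpace L (-g)
  rw [this, Finset.sum_pair (halfSpace_ne_halfSpace_neg hg)]

/-- The subspace `L` of weight `m`, subdivided by the hyperplane `g = 0`. -/
def splitFan {L : Submodule ℝ V} (hL : IsRationalSubspace Λ L) {g : V →ₗ[ℝ] ℝ}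
    (hg : IsIntegerValued Λ g) {c : ℤ} (hc : IsGenerator g (latticeIn Λ L) c) (m : ℤ) :
    TropicalFan Λ where
  dim := Module.finrank ℝ L
  cones := splitCones L g
  weight := fun _ => m
  rational := by
    intro σ hσ
    rcases mem_splitCones.1 hσ with rfl | rfl | rfl
    · exact isRationalPolyhedral_halfSpace hc (hL.inf_ker hg)
    · exact isRationalPolyhedral_halfSpace hc.neg (by rw [inf_ker_neg]; exact hL.inf_ker hg)
    · exact isRationalPolyhedral_ofSubmodule (hL.inf_ker hg)
  face_mem := by
    intro σ hσ τ hτ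
    rw [mem_splitCones] at hσ ⊢
    rcases hσ with rfl | rfl | rfl
    · rcases eq_or_eq_of_isFaceOf_halfSpace hτ with h | h
      · exact Or.inl h
      · exact Or.inr (Or.inr h)
    · rcases eq_or_eq_of_isFaceOf_halfSpace hτ with h | h
      · exact Or.inr (Or.inl h)
      · exact Or.inr (Or.inr (by rw [h, inf_ker_neg]))
    · exact Or.inr (Or.inr (eq_of_isFaceOf_ofSubmodule hτ))
  inter_face := by
    have h1 := ofSubmodule_inf_ker_le_halfSpace L g
    have h2 := ofSubmodule_inf_ker_le_halfSpace L (-g)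
    have h3 := isFaceOf_halfSpace L g
    have h4 := isFaceOf_halfSpace L (-g)
    have h5 := halfSpace_inf_halfSpace_neg L g
    rw [inf_ker_neg] at h2 h4
    intro σ hσ σ' hσ'
    rcases mem_splitCones.1 hσ with rfl | rfl | rfl <;>
    rcases mem_splitCones.1 hσ' with rfl | rfl | rfl
    · rw [inf_idem]
    · rw [h5]; exact h3
    · rw [inf_eq_right.2 h1]; exact h3
    · rw [inf_comm, h5]; exact h4
    · rw [inf_idem]
    · rw [inf_eq_right.2 h2]; exact h4
    · rw [inf_eq_left.2 h1]
    · rw [inf_eq_left.2 h2]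
    · rw [inf_idem]
  pure := by
    have hp := exists_pos_of_isGenerator hc
    have hn := exists_pos_of_isGenerator hc.neg
    intro τ hτ
    rcases mem_splitCones.1 hτ with rfl | rfl | rfl
    · exact ⟨_, hτ, le_rfl, coneDim_halfSpace hp⟩
    · exact ⟨_, hτ, le_rfl, coneDim_halfSpace hn⟩
    · exact ⟨halfSpace L g, mem_splitCones.2 (Or.inl rfl), ofSubmodule_inf_ker_le_halfSpace L g,
        coneDim_halfSpace hp⟩
  balanced := by
    have hp := exists_pos_of_isGenerator hc
    have hn := exists_pos_of_isGenerator hc.neg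
    intro τ hτ hdim
    rcases mem_splitCones.1 hτ with rfl | rfl | rfl
    · rw [coneDim_halfSpace hp] at hdim
      omega
    · rw [coneDim_halfSpace hn] at hdim
      omega
    · rw [sum_conesAround_splitCones hp, coneSpan_ofSubmodule]
      have hs := coneSpan_halfSpace hp
      have hs' := coneSpan_halfSpace hn
      have hgen : IsGenerator g (coneLattice Λ (halfSpace L g)) c := by rwa [coneLattice, hs]
      have hgen' : IsGenerator (-g) (coneLattice Λ (halfSpace L (-g))) c := by
        rw [coneLattice, hs']; exact hc.neg
      have hv := isPrimitiveVector_primitiveVector (exists_isPrimitiveVector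
        (τ := PointedCone.ofSubmodule (L ⊓ LinearMap.ker g)) hgen
        (by rw [coneSpan_ofSubmodule, hs]) fun s h => h.2)
      have hv' := isPrimitiveVector_primitiveVector (exists_isPrimitiveVector
        (τ := PointedCone.ofSubmodule (L ⊓ LinearMap.ker g)) hgen'
        (by rw [coneSpan_ofSubmodule, hs', inf_ker_neg]) fun s h => h.2)
      have e := hv.apply_eq hgen (by rw [coneSpan_ofSubmodule]; exact inf_le_right) fun s h => h.2
      have e' := hv'.apply_eq hgen'
        (by rw [coneSpan_ofSubmodule, ← inf_ker_neg]; exact inf_le_right) fun s h => h.2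
      have hm := hv.mem_coneSpan
      have hm' := hv'.mem_coneSpan
      rw [hs] at hm
      rw [hs'] at hm'
      refine ⟨add_mem (zsmul_mem hm _) (zsmul_mem hm' _), ?_⟩
      change g _ = 0
      rw [LinearMap.neg_apply] at e'
      rw [map_add, map_zsmul, map_zsmul, zsmul_eq_mul, zsmul_eq_mul, e]
      linear_combination (-(m : ℝ)) * e'

theorem representsSubspace_splitFan {L : Submodule ℝ V} (hL : IsRationalSubspace Λ L)
    {g : V →ₗ[ℝ] ℝ} (hg : IsIntegerValued Λ g) {c : ℤ} (hc : IsGenerator g (latticeIn Λ L) c)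
    {m : ℤ} (hm : m ≠ 0) : RepresentsSubspace (splitFan hL hg hc m) L m where
  dim_eq := rfl
  weight_eq _ _ := rfl
  support_eq := by
    have hp := exists_pos_of_isGenerator hc
    have hn := exists_pos_of_isGenerator hc.neg
    ext v
    constructor
    · rintro ⟨σ, hσ, hv⟩
      rcases mem_splitCones.1 hσ.1 with rfl | rfl | rfl
      all_goals exact hv.1
    · intro hv
      rcases le_total 0 (g v) with h | h
      · exact ⟨_, ⟨mem_splitCones.2 (Or.inl rfl), coneDim_halfSpace hp, hm⟩, hv, h⟩
      · exact ⟨_, ⟨mem_splitCones.2 (Or.inr (Or.inl rfl)), coneDim_halfSpace hn, hm⟩,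
          mem_halfSpace.2 ⟨hv, by simpa using h⟩⟩

theorem isRationalFunction_splitFan {L : Submodule ℝ V} (hL : IsRationalSubspace Λ L)
    {x y : V →ₗ[ℝ] ℝ} (hx : IsIntegerValued Λ x) (hy : IsIntegerValued Λ y)
    (hg : IsIntegerValued Λ (x - y)) {c : ℤ} (hc : IsGenerator (x - y) (latticeIn Λ L) c) {m : ℤ} :
    IsRationalFunction (fun v => max (x v) (y v)) (splitFan hL hg hc m) := by
  intro σ hσ
  rcases mem_splitCones.1 hσ with rfl | rfl | rfl
  · refine ⟨x, fun v hv => max_eq_left ?_, fun v hv => hx v hv.1⟩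
    have := (mem_halfSpace.1 hv).2
    rw [LinearMap.sub_apply] at this
    linarith
  · refine ⟨y, fun v hv => max_eq_right ?_, fun v hv => hy v hv.1⟩
    have := (mem_halfSpace.1 hv).2
    rw [LinearMap.neg_apply, LinearMap.sub_apply] at this
    linarith
  · refine ⟨x, fun v hv => max_eq_left ?_, fun v hv => hx v hv.1⟩
    have : (x - y) v = 0 := hv.2
    rw [LinearMap.sub_apply] at this
    linarith

/-- The only cone of the split fan below full dimension is L ⊓ ker (x - y), so the skeleton is the
one-cone fan of that subspace. -/
theorem isDivisor_splitFan {L : Submodule ℝ V} (hL : IsRationalSubspace Λ L)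
    {x y : V →ₗ[ℝ] ℝ} (hx : IsIntegerValued Λ x) (hy : IsIntegerValued Λ y)
    (hg : IsIntegerValued Λ (x - y)) {c : ℤ} (hc : IsGenerator (x - y) (latticeIn Λ L) c)
    {m : ℤ} (hm : m ≠ 0) :
    IsDivisor (fun v => max (x v) (y v)) (splitFan hL hg hc m)
      (ofSubspace (L ⊓ LinearMap.ker (x - y)) (hL.inf_ker hg) (m * c)) := by
  classical
  have hp := exists_pos_of_isGenerator hc
  have hn := exists_pos_of_isGenerator hc.neg
  have hdim := coneDim_inf_ker_add_one hp
  have hφ := isRationalFunction_splitFan hL hx hy hg hc (m := m)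
  refine ⟨hφ, ?_, ?_, fun τ hτ hd => ?_⟩
  · rw [coneDim_ofSubmodule] at hdim
    change Module.finrank ℝ _ = Module.finrank ℝ L - 1
    omega
  · ext σ
    change σ ∈ ({_} : Finset (PointedCone ℝ V)) ↔
      σ ∈ (splitCones L (x - y)).filter (fun σ => coneDim σ < Module.finrank ℝ L)
    rw [Finset.mem_singleton, Finset.mem_filter, mem_splitCones]
    constructor
    · rintro rfl
      exact ⟨Or.inr (Or.inr rfl), by omega⟩
    · rintro ⟨rfl | rfl | rfl, hlt⟩
      · rw [coneDim_halfSpace hp] at hlt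
        omega
      · rw [coneDim_halfSpace hn] at hlt
        omega
      · rfl
  · have hd' : coneDim τ + 1 = Module.finrank ℝ L := hd
    have hker : ∀ t ∈ τ, t ∈ L ⊓ LinearMap.ker (x - y) := by
      rcases mem_splitCones.1 hτ with rfl | rfl | rfl
      · rw [coneDim_halfSpace hp] at hd'
        omega
      · rw [coneDim_halfSpace hn] at hd'
        omega
      · exact fun t ht => ht
    rw [(representsSubspace_splitFan hL hg hc hm).divisorWeight_of_le hφ hc hτ hd hker]
    change ((m * c : ℤ) : ℝ) = _
    push_cast
    rfl

/-- The divisor of `max x y` on the cycle of a rational subspace. -/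
theorem divisor_cycle_ofSubspace (hΛ : HasIntegralBasis Λ) {L : Submodule ℝ V}
    (hL : IsRationalSubspace Λ L) {x y : V →ₗ[ℝ] ℝ} (hx : IsIntegerValued Λ x)
    (hy : IsIntegerValued Λ y) {c : ℤ} (hc : IsGenerator (x - y) (latticeIn Λ L) c) {m : ℤ}
    (hm : m ≠ 0) (hK : IsRationalSubspace Λ (L ⊓ LinearMap.ker (x - y))) :
    divisor (fun v => max (x v) (y v)) (cycle (ofSubspace L hL m)) =
      cycle (ofSubspace (L ⊓ LinearMap.ker (x - y)) hK (m * c)) := by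
  have hg : IsIntegerValued Λ (x - y) := fun v hv => by
    obtain ⟨a, ha⟩ := hx v hv
    obtain ⟨b, hb⟩ := hy v hv
    exact ⟨a - b, by simp [ha, hb]⟩
  have hmc : m * c ≠ 0 := mul_ne_zero hm hc.pos.ne'
  ext Z
  constructor
  · rintro ⟨X, hX, D, hD, hZ⟩
    rw [mem_cycle_ofSubspace_iff hL hm] at hX
    rw [mem_cycle_ofSubspace_iff hK hmc]
    exact (hX.of_isDivisor hΛ hm hc hD).of_mem_cycle hZ
  · intro hZ
    exact ⟨splitFan hL hg hc m,
      (mem_cycle_ofSubspace_iff hL hm).2 (representsSubspace_splitFan hL hg hc hm), _,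
      isDivisor_splitFan hL hx hy hg hc hm, hZ⟩

end

section

/-! ### Products and push-forwards of subspaces -/

theorem coneSpan_prod (σ : PointedCone ℝ V) (σ' : PointedCone ℝ V') :
    coneSpan (Submodule.prod σ σ') = (coneSpan σ).prod (coneSpan σ') := by
  refine le_antisymm (coneSpan_le.2 fun z hz => ⟨le_coneSpan hz.1, le_coneSpan hz.2⟩) ?_
  rintro ⟨a, b⟩ ⟨ha, hb⟩
  have h1 : coneSpan σ ≤ (coneSpan (Submodule.prod σ σ')).comap (LinearMap.inl ℝ V V') :=
    coneSpan_le.2 fun x hx => le_coneSpan ⟨hx, zero_mem σ'⟩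
  have h2 : coneSpan σ' ≤ (coneSpan (Submodule.prod σ σ')).comap (LinearMap.inr ℝ V V') :=
    coneSpan_le.2 fun x hx => le_coneSpan ⟨zero_mem σ, hx⟩
  have ha' := Submodule.mem_comap.1 (h1 ha)
  have hb' := Submodule.mem_comap.1 (h2 hb)
  simpa using add_mem ha' hb'

theorem finrank_prod_submodule [FiniteDimensional ℝ V] [FiniteDimensional ℝ V']
    (U : Submodule ℝ V) (W : Submodule ℝ V') :
    Module.finrank ℝ (U.prod W) = Module.finrank ℝ U + Module.finrank ℝ W := by
  rw [← Module.finrank_prod]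
  refine (LinearEquiv.finrank_eq (LinearEquiv.ofBijective
    ((U.subtype.prodMap W.subtype).codRestrict (U.prod W) fun z => ⟨z.1.2, z.2.2⟩)
    ⟨fun a b h => ?_, fun z => ⟨(⟨z.1.1, z.2.1⟩, ⟨z.1.2, z.2.2⟩), rfl⟩⟩)).symm
  have h' := congrArg Subtype.val h
  exact Prod.ext (Subtype.ext (congrArg Prod.fst h')) (Subtype.ext (congrArg Prod.snd h'))

theorem latticeIn_prod (U : Submodule ℝ V) (W : Submodule ℝ V') :
    latticeIn (Λ.prod Λ') (U.prod W) = (latticeIn Λ U).prod (latticeIn Λ' W) := by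
  ext ⟨a, b⟩
  constructor
  · rintro ⟨⟨h1, h2⟩, h3, h4⟩
    exact ⟨⟨h1, h3⟩, h2, h4⟩
  · rintro ⟨⟨h1, h3⟩, h2, h4⟩
    exact ⟨⟨h1, h2⟩, h3, h4⟩

theorem IsRationalSubspace.prod {U : Submodule ℝ V} {W : Submodule ℝ V'}
    (hU : IsRationalSubspace Λ U) (hW : IsRationalSubspace Λ' W) :
    IsRationalSubspace (Λ.prod Λ') (U.prod W) := by
  refine le_antisymm (Submodule.span_le.2 fun z hz => hz.2) ?_
  rintro ⟨a, b⟩ ⟨ha, hb⟩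
  rw [latticeIn_prod]
  set S := Submodule.span ℝ ((latticeIn Λ U).prod (latticeIn Λ' W) : Set (V × V')) with hS
  have h1 : U ≤ S.comap (LinearMap.inl ℝ V V') := by
    rw [← hU]
    exact Submodule.span_le.2 fun x hx => Submodule.subset_span ⟨hx, zero_mem (latticeIn Λ' W)⟩
  have h2 : W ≤ S.comap (LinearMap.inr ℝ V V') := by
    rw [← hW]
    exact Submodule.span_le.2 fun x hx => Submodule.subset_span ⟨zero_mem (latticeIn Λ U), hx⟩
  have ha' := Submodule.mem_comap.1 (h1 ha)
  have hb' := Submodule.mem_comap.1 (h2 hb)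
  simpa using add_mem ha' hb'

section Product

variable [FiniteDimensional ℝ V] [FiniteDimensional ℝ V']

theorem coneDim_prod (σ : PointedCone ℝ V) (σ' : PointedCone ℝ V') :
    coneDim (Submodule.prod σ σ') = coneDim σ + coneDim σ' := by
  rw [coneDim, coneSpan_prod, finrank_prod_submodule]
  rfl

/-- Dimensions add and are bounded in each factor, so a product cone is a facet only if both factors
are; its weight is nonzero only if both weights are. -/
theorem RepresentsSubspace.of_isCartesianProduct {X : TropicalFan Λ} {Y : TropicalFan Λ'}
    {P : TropicalFan (Λ.prod Λ')} {U : Submodule ℝ V} {W : Submodule ℝ V'} {m n : ℤ}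
    (hX : RepresentsSubspace X U m) (hY : RepresentsSubspace Y W n)
    (hP : IsCartesianProduct X Y P) : RepresentsSubspace P (U.prod W) (m * n) := by
  classical
  obtain ⟨hdim, hcones, hw⟩ := hP
  have hmem : ∀ ρ, ρ ∈ P.cones ↔ ∃ σ ∈ X.cones, ∃ σ' ∈ Y.cones, Submodule.prod σ σ' = ρ := by
    intro ρ
    rw [hcones, Finset.mem_image₂]
  have facet : ∀ ρ, IsWeightedFacet P ρ → ∃ σ σ', IsWeightedFacet X σ ∧ IsWeightedFacet Y σ' ∧
      ρ = Submodule.prod σ σ' ∧ P.weight ρ = X.weight σ * Y.weight σ' := by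
    rintro ρ ⟨hρ, hd, hne⟩
    obtain ⟨σ, hσ, σ', hσ', rfl⟩ := (hmem ρ).1 hρ
    have h1 := X.coneDim_le hσ
    have h2 := Y.coneDim_le hσ'
    rw [coneDim_prod, hdim] at hd
    have e := hw σ hσ σ' hσ' (by omega) (by omega)
    rw [e] at hne
    exact ⟨σ, σ', ⟨hσ, by omega, left_ne_zero_of_mul hne⟩,
      ⟨hσ', by omega, right_ne_zero_of_mul hne⟩, rfl, e⟩
  refine ⟨by rw [hdim, hX.dim_eq, hY.dim_eq, finrank_prod_submodule], ?_, fun ρ hρ => ?_⟩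
  · ext ⟨a, b⟩
    constructor
    · rintro ⟨ρ, hρ, hz⟩
      obtain ⟨σ, σ', hσ, hσ', rfl, -⟩ := facet ρ hρ
      exact ⟨hX.mem_of_isWeightedFacet hσ hz.1, hY.mem_of_isWeightedFacet hσ' hz.2⟩
    · rintro ⟨ha, hb⟩
      obtain ⟨σ, hσ, haσ⟩ := hX.exists_isWeightedFacet ha
      obtain ⟨σ', hσ', hbσ⟩ := hY.exists_isWeightedFacet hb
      refine ⟨Submodule.prod σ σ', ⟨(hmem _).2 ⟨σ, hσ.1, σ', hσ'.1, rfl⟩, ?_, ?_⟩, haσ, hbσ⟩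
      · rw [coneDim_prod, hdim, hσ.2.1, hσ'.2.1]
      · rw [hw σ hσ.1 σ' hσ'.1 hσ.2.1 hσ'.2.1]
        exact mul_ne_zero hσ.2.2 hσ'.2.2
  · obtain ⟨σ, σ', hσ, hσ', -, e⟩ := facet ρ hρ
    rw [e, hX.weight_eq σ hσ, hY.weight_eq σ' hσ']

theorem isCartesianProduct_ofSubspace {U : Submodule ℝ V} {W : Submodule ℝ V'}
    (hU : IsRationalSubspace Λ U) (hW : IsRationalSubspace Λ' W) (m n : ℤ) :
    IsCartesianProduct (ofSubspace U hU m) (ofSubspace W hW n)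
      (ofSubspace (U.prod W) (hU.prod hW) (m * n)) := by
  classical
  refine ⟨finrank_prod_submodule U W, ?_, fun _ _ _ _ _ _ => rfl⟩
  change ({_} : Finset (PointedCone ℝ (V × V'))) = Finset.image₂ _ {_} {_}
  rw [Finset.image₂_singleton]
  rfl

/-- The cartesian product of two subspaces, as cycles. -/
theorem cartesianProduct_cycle_ofSubspace {U : Submodule ℝ V} {W : Submodule ℝ V'}
    (hU : IsRationalSubspace Λ U) (hW : IsRationalSubspace Λ' W) {m n : ℤ} (hm : m ≠ 0)
    (hn : n ≠ 0) :
    cartesianProduct (cycle (ofSubspace U hU m)) (cycle (ofSubspace W hW n)) =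
      cycle (ofSubspace (U.prod W) (hU.prod hW) (m * n)) := by
  ext Z
  constructor
  · rintro ⟨X, hX, Y, hY, P, hP, hZ⟩
    rw [mem_cycle_ofSubspace_iff _ hm] at hX
    rw [mem_cycle_ofSubspace_iff _ hn] at hY
    rw [mem_cycle_ofSubspace_iff _ (mul_ne_zero hm hn)]
    exact (hX.of_isCartesianProduct hY hP).of_mem_cycle hZ
  · intro hZ
    exact ⟨_, (mem_cycle_ofSubspace_iff _ hm).2 (representsSubspace_ofSubspace U hU hm), _,
      (mem_cycle_ofSubspace_iff _ hn).2 (representsSubspace_ofSubspace W hW hn), _,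
      isCartesianProduct_ofSubspace hU hW m n, hZ⟩

end Product

/-! ### Push-forward along a map injective on the subspace. -/

theorem coneSpan_map (f : V →ₗ[ℝ] V') (σ : PointedCone ℝ V) :
    coneSpan (σ.map f) = (coneSpan σ).map f := by
  rw [coneSpan, PointedCone.coe_map, ← Submodule.map_span]
  rfl

theorem finrank_map_of_injOn {f : V →ₗ[ℝ] V'} {L : Submodule ℝ V} (hf : Set.InjOn f L) :
    Module.finrank ℝ (L.map f) = Module.finrank ℝ L := by
  rw [← LinearMap.range_domRestrict]
  refine LinearMap.finrank_range_of_inj fun a b h => Subtype.ext (hf a.2 b.2 h)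

theorem latticeIndex_self {G : Type*} [AddCommGroup G] (A : Submodule ℤ G) : latticeIndex A A = 1 := by
  rw [latticeIndex, Nat.card_eq_one_iff_unique]
  refine ⟨?_, inferInstance⟩
  rw [Submodule.Quotient.subsingleton_iff]
  exact Submodule.comap_subtype_self A

theorem IsRationalSubspace.map {f : V →ₗ[ℝ] V'} {L : Submodule ℝ V} (hL : IsRationalSubspace Λ L)
    (hf : ∀ v ∈ Λ, f v ∈ Λ') : IsRationalSubspace Λ' (L.map f) := by
  refine le_antisymm (Submodule.span_le.2 fun z hz => hz.2) ?_
  conv_lhs => rw [← hL]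
  refine (Submodule.map_span_le f _ _).2 fun v hv => Submodule.subset_span ⟨hf v hv.1, ?_⟩
  exact Submodule.mem_map_of_mem hv.2

variable [FiniteDimensional ℝ V]

/-- Weighted facets lie in L, where f is injective, so distinct ones have distinct images and each
weight sum has at most one nonzero term; `hmap` makes its lattice index 1. -/
theorem RepresentsSubspace.of_isPushforward {f : V →ₗ[ℝ] V'} {L : Submodule ℝ V}
    (hinj : Set.InjOn f L)
    (hmap : (latticeIn Λ L).map (f.restrictScalars ℤ) = latticeIn Λ' (L.map f))
    {X : TropicalFan Λ} {m : ℤ} (h : RepresentsSubspace X L m)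
    {Y : TropicalFan Λ'} (hY : IsPushforward f X Y) : RepresentsSubspace Y (L.map f) m := by
  classical
  obtain ⟨-, hdim, hmem, hw⟩ := hY
  have hdimY : Y.dim = Module.finrank ℝ (L.map f) := by
    rw [hdim, h.dim_eq, finrank_map_of_injOn hinj]
  have hspan : ∀ {σ}, IsWeightedFacet X σ → coneSpan (σ.map f) = L.map f := fun hσ => by
    rw [coneSpan_map, h.coneSpan_eq hσ]
  have hdimσ : ∀ {σ}, IsWeightedFacet X σ → coneDim (σ.map f) = Y.dim := fun hσ => by
    rw [coneDim, hspan hσ, hdimY]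
  have weight : ∀ {σ}, IsWeightedFacet X σ → σ.map f ∈ Y.cones → Y.weight (σ.map f) = m := by
    intro σ hσ hσY
    rw [hw _ hσY (hdimσ hσ), Finset.sum_eq_single σ]
    · have e1 : coneLattice Λ' (σ.map f) = latticeIn Λ' (L.map f) := by
        rw [coneLattice, hspan hσ]
      have e2 : coneLattice Λ σ = latticeIn Λ L := by rw [coneLattice, h.coneSpan_eq hσ]
      rw [e1, e2, hmap, latticeIndex_self, h.weight_eq σ hσ, Nat.cast_one, one_mul]
    · intro ρ hρ hne
      obtain ⟨hρX, hρd, hρmap⟩ := Finset.mem_filter.1 hρ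
      suffices X.weight ρ = 0 by rw [this, mul_zero]
      by_contra hρw
      have hρf : IsWeightedFacet X ρ := ⟨hρX, hρd, hρw⟩
      have key : ∀ {α β}, IsWeightedFacet X α → IsWeightedFacet X β → α.map f = β.map f →
          α ≤ β := by
        intro α β hα hβ e a ha
        have : f a ∈ β.map f := e ▸ PointedCone.mem_map.2 ⟨a, ha, rfl⟩
        obtain ⟨b, hb, hfb⟩ := PointedCone.mem_map.1 this
        have : b = a := hinj (h.mem_of_isWeightedFacet hβ hb) (h.mem_of_isWeightedFacet hα ha) hfb
        exact this ▸ hb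
      exact hne (le_antisymm (key hρf hσ hρmap) (key hσ hρf hρmap.symm))
    · intro hn
      exact absurd (Finset.mem_filter.2 ⟨hσ.1, hσ.2.1, rfl⟩) hn
  have facet : ∀ {σ'}, IsWeightedFacet Y σ' → ∃ σ, IsWeightedFacet X σ ∧ σ.map f = σ' := by
    rintro σ' ⟨hσ', hd, hne⟩
    rw [hw σ' hσ' hd] at hne
    obtain ⟨σ, hσ, hne⟩ := Finset.exists_ne_zero_of_sum_ne_zero hne
    obtain ⟨hσX, hσd, e⟩ := Finset.mem_filter.1 hσ
    exact ⟨σ, ⟨hσX, hσd, right_ne_zero_of_mul hne⟩, e⟩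
  refine ⟨hdimY, ?_, fun σ' hσ' => ?_⟩
  · ext z
    constructor
    · rintro ⟨σ', hσ', hz⟩
      obtain ⟨σ, hσ, rfl⟩ := facet hσ'
      obtain ⟨a, ha, rfl⟩ := PointedCone.mem_map.1 hz
      exact Submodule.mem_map_of_mem (h.mem_of_isWeightedFacet hσ ha)
    · rintro ⟨a, ha, rfl⟩
      obtain ⟨σ, hσ, haσ⟩ := h.exists_isWeightedFacet ha
      have hσY := hmem σ hσ.1 hσ.2.1 ((hdimσ hσ).trans hdim)
      refine ⟨σ.map f, ⟨hσY, hdimσ hσ, ?_⟩, PointedCone.mem_map.2 ⟨a, haσ, rfl⟩⟩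
      rw [weight hσ hσY, ← h.weight_eq σ hσ]
      exact hσ.2.2
  · obtain ⟨σ, hσ, rfl⟩ := facet hσ'
    exact weight hσ hσ'.1

variable [FiniteDimensional ℝ V']

theorem isPushforward_ofSubspace {f : V →ₗ[ℝ] V'} (hf : ∀ v ∈ Λ, f v ∈ Λ') {L : Submodule ℝ V}
    (hinj : Set.InjOn f L)
    (hmap : (latticeIn Λ L).map (f.restrictScalars ℤ) = latticeIn Λ' (L.map f))
    (hL : IsRationalSubspace Λ L) (hK : IsRationalSubspace Λ' (L.map f)) (m : ℤ) :
    IsPushforward f (ofSubspace L hL m) (ofSubspace (L.map f) hK m) := by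
  classical
  have hcone : (PointedCone.ofSubmodule L).map f = PointedCone.ofSubmodule (L.map f) := rfl
  refine ⟨hf, finrank_map_of_injOn hinj, fun σ hσ _ _ => ?_, fun σ' hσ' hd => ?_⟩
  · rw [Finset.mem_singleton.1 hσ, hcone]
    exact Finset.mem_singleton_self _
  · rw [Finset.mem_singleton.1 hσ']
    have : (ofSubspace L hL m).cones.filter (fun σ => coneDim σ = (ofSubspace L hL m).dim ∧
        σ.map f = PointedCone.ofSubmodule (L.map f)) = {PointedCone.ofSubmodule L} := by
      refine Finset.filter_true_of_mem fun σ hσ => ?_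
      rw [Finset.mem_singleton.1 hσ]
      exact ⟨coneDim_ofSubmodule L, hcone⟩
    rw [this, Finset.sum_singleton, coneLattice, coneLattice, coneSpan_ofSubmodule,
      coneSpan_ofSubmodule, hmap, latticeIndex_self, Nat.cast_one, one_mul]
    rfl

/-- The push-forward of a subspace along a map that is injective on it and on lattices. -/
theorem pushforward_cycle_ofSubspace {f : V →ₗ[ℝ] V'} (hf : ∀ v ∈ Λ, f v ∈ Λ')
    {L : Submodule ℝ V} {K : Submodule ℝ V'} (hinj : Set.InjOn f L) (hLK : L.map f = K)
    (hmap : (latticeIn Λ L).map (f.restrictScalars ℤ) = latticeIn Λ' K)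
    (hL : IsRationalSubspace Λ L) (hK : IsRationalSubspace Λ' K) {m : ℤ} (hm : m ≠ 0) :
    pushforward Λ' f (cycle (ofSubspace L hL m)) = cycle (ofSubspace K hK m) := by
  subst hLK
  ext Z
  constructor
  · rintro ⟨X, hX, Y, hY, hZ⟩
    rw [mem_cycle_ofSubspace_iff _ hm] at hX ⊢
    exact (hX.of_isPushforward hinj hmap hY).of_mem_cycle hZ
  · intro hZ
    exact ⟨_, (mem_cycle_ofSubspace_iff _ hm).2 (representsSubspace_ofSubspace L hL hm), _,
      isPushforward_ofSubspace hf hinj hmap hL hK m, hZ⟩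

end


/-! ### Indices of lattices -/

theorem relIndex_zmultiples_real (c : ℤ) (hc : 0 < c) :
    ((AddSubgroup.zmultiples (c : ℝ)).relIndex (AddSubgroup.zmultiples (1 : ℝ)) : ℤ) = c := by
  have h1 : AddSubgroup.zmultiples (c : ℝ) =
      (AddSubgroup.zmultiples c).map (Int.castAddHom ℝ) := by
    rw [AddMonoidHom.map_zmultiples]; rfl
  have h2 : AddSubgroup.zmultiples (1 : ℝ) = (⊤ : AddSubgroup ℤ).map (Int.castAddHom ℝ) := by
    rw [← Int.zmultiples_one, AddMonoidHom.map_zmultiples]; simp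
  rw [h1, h2, AddSubgroup.relIndex_map_map_of_injective _ _ Int.cast_injective,
    AddSubgroup.relIndex_top_right, Int.index_zmultiples]
  omega

/-- The index of `M` in `A` is the product of the indices on the kernel and on the image of a
form. -/
theorem relIndex_eq_mul_relIndex_inf_ker {M A : AddSubgroup V} {h : V →ₗ[ℝ] ℝ} {c : ℤ}
    (hc : 0 < c) (hA : ∀ a ∈ A, ∃ n : ℤ, h a = n) (hA1 : ∃ a ∈ A, h a = 1)
    (hM : ∀ v ∈ M ⊓ A, ∃ n : ℤ, h v = n * c) (hMc : ∃ v ∈ M ⊓ A, h v = c) :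
    (M.relIndex A : ℤ) = c * M.relIndex (A ⊓ h.toAddMonoidHom.ker) := by
  -- With B = M ∩ A: [A : B] = [A : B + K] [B + K : B]. The first factor is [ℤ : cℤ], because B + K
  -- is the preimage of cℤ in A; the second is [K : B ∩ K].
  set K := A ⊓ h.toAddMonoidHom.ker with hK
  set B := M ⊓ A with hB
  have e1 : B.relIndex K = M.relIndex K := by
    rw [← AddSubgroup.inf_relIndex_right, ← AddSubgroup.inf_relIndex_right M, hB, hK]
    congr 1
    ext; simp; tauto
  have e2 : (B ⊔ K).relIndex A = (AddSubgroup.zmultiples (c : ℝ)).relIndex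
      (AddSubgroup.zmultiples (1 : ℝ)) := by
    have hmap : A.map h.toAddMonoidHom = AddSubgroup.zmultiples (1 : ℝ) := by
      ext t
      rw [AddSubgroup.mem_map, AddSubgroup.mem_zmultiples_iff]
      constructor
      · rintro ⟨a, ha, rfl⟩
        obtain ⟨n, hn⟩ := hA a ha
        exact ⟨n, by simp [hn]⟩
      · rintro ⟨n, rfl⟩
        obtain ⟨a, ha, h1⟩ := hA1
        exact ⟨n • a, zsmul_mem ha n, by simp [h1]⟩
    rw [← hmap, ← AddSubgroup.relIndex_comap, ← AddSubgroup.inf_relIndex_right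
      ((AddSubgroup.zmultiples (c : ℝ)).comap _)]
    congr 1
    refine le_antisymm (sup_le (le_inf ?_ inf_le_right) (le_inf ?_ inf_le_left)) ?_
    · intro v hv
      obtain ⟨n, hn⟩ := hM v hv
      rw [AddSubgroup.mem_comap, AddSubgroup.mem_zmultiples_iff]
      exact ⟨n, by simp [hn]⟩
    · intro v hv
      have : h v = 0 := hv.2
      rw [AddSubgroup.mem_comap, AddSubgroup.mem_zmultiples_iff]
      exact ⟨0, by simp [this]⟩
    · rintro v ⟨hv, hvA⟩
      obtain ⟨n, hn⟩ := AddSubgroup.mem_zmultiples_iff.1 (AddSubgroup.mem_comap.1 hv)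
      obtain ⟨w, hw, hwc⟩ := hMc
      rw [AddSubgroup.mem_sup]
      refine ⟨n • w, zsmul_mem hw n, v - n • w, ⟨A.sub_mem hvA (A.zsmul_mem hw.2 n), ?_⟩, by abel⟩
      change h (v - n • w) = 0
      have hn' : n • (c : ℝ) = h v := hn
      rw [map_sub, map_zsmul, hwc, hn', sub_self]
  have e3 : B.relIndex (B ⊔ K) = B.relIndex K := AddSubgroup.relIndex_sup_left _ _
  have e4 := AddSubgroup.relIndex_mul_relIndex B (B ⊔ K) A le_sup_left
    (sup_le inf_le_right inf_le_left)
  rw [← AddSubgroup.inf_relIndex_right M, ← hB, ← e4, e3, e1, e2]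
  push_cast
  rw [relIndex_zmultiples_real c hc, mul_comm]

/-! ### The intersection product of two subspaces -/

/-- The difference of the `i`-th coordinates of the two factors of `V × V`. -/
def coordDiff {r : ℕ} (b : Module.Basis (Fin r) ℝ V) (i : Fin r) : V × V →ₗ[ℝ] ℝ :=
  b.coord i ∘ₗ LinearMap.fst ℝ V V - b.coord i ∘ₗ LinearMap.snd ℝ V V

theorem coordDiff_apply {r : ℕ} (b : Module.Basis (Fin r) ℝ V) (i : Fin r) (p : V × V) :
    coordDiff b i p = b.coord i (p.1 - p.2) := by
  rw [map_sub]; rfl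

/-- The part of a subspace of `V × V` where the coordinates in a list agree on both factors. -/
def agreeOn {r : ℕ} (b : Module.Basis (Fin r) ℝ V) (L : Submodule ℝ (V × V)) (l : List (Fin r)) :
    Submodule ℝ (V × V) :=
  l.foldr (fun i K => K ⊓ LinearMap.ker (coordDiff b i)) L

theorem agreeOn_cons {r : ℕ} (b : Module.Basis (Fin r) ℝ V) (L : Submodule ℝ (V × V)) (i : Fin r)
    (l : List (Fin r)) : agreeOn b L (i :: l) = agreeOn b L l ⊓ LinearMap.ker (coordDiff b i) :=
  rfl

theorem mem_agreeOn {r : ℕ} {b : Module.Basis (Fin r) ℝ V} {L : Submodule ℝ (V × V)}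
    {l : List (Fin r)} {p : V × V} :
    p ∈ agreeOn b L l ↔ p ∈ L ∧ ∀ i ∈ l, b.coord i (p.1 - p.2) = 0 := by
  induction l with
  | nil => simp [agreeOn]
  | cons i l ih =>
    rw [agreeOn_cons, Submodule.mem_inf, ih, LinearMap.mem_ker, coordDiff_apply,
      List.forall_mem_cons]
    tauto

/-- The lattice vectors whose coordinates in a list vanish. -/
def vanishingOn {r : ℕ} (b : Module.Basis (Fin r) ℝ V) (Λ : Submodule ℤ V) (l : List (Fin r)) :
    AddSubgroup V :=
  l.foldr (fun i K => K ⊓ (b.coord i).toAddMonoidHom.ker) Λ.toAddSubgroup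

theorem vanishingOn_cons {r : ℕ} (b : Module.Basis (Fin r) ℝ V) (i : Fin r) (l : List (Fin r)) :
    vanishingOn b Λ (i :: l) = vanishingOn b Λ l ⊓ (b.coord i).toAddMonoidHom.ker :=
  rfl

theorem mem_vanishingOn {r : ℕ} {b : Module.Basis (Fin r) ℝ V} {l : List (Fin r)} {v : V} :
    v ∈ vanishingOn b Λ l ↔ v ∈ Λ ∧ ∀ i ∈ l, b.coord i v = 0 := by
  induction l with
  | nil => simp [vanishingOn]
  | cons i l ih =>
    rw [vanishingOn_cons, AddSubgroup.mem_inf, ih, AddMonoidHom.mem_ker, List.forall_mem_cons]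
    change (_ ∧ b.coord i v = 0) ↔ _
    tauto

theorem isIntegerValued_coord {r : ℕ} {b : Module.Basis (Fin r) ℝ V}
    (hb : Submodule.span ℤ (Set.range b) = Λ) (i : Fin r) : IsIntegerValued Λ (b.coord i) := by
  intro v hv
  rw [← hb] at hv
  induction hv using Submodule.span_induction with
  | mem x hx =>
    obtain ⟨j, rfl⟩ := hx
    by_cases h : j = i
    · exact ⟨1, by simp [h]⟩
    · exact ⟨0, by simp [h]⟩
  | zero => exact ⟨0, by simp⟩
  | add x y _ _ hx hy =>
    obtain ⟨m, hm⟩ := hx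
    obtain ⟨n, hn⟩ := hy
    exact ⟨m + n, by rw [map_add, hm, hn, Int.cast_add]⟩
  | smul k x _ hx =>
    obtain ⟨m, hm⟩ := hx
    exact ⟨k * m, by rw [map_zsmul, hm, zsmul_eq_mul, Int.cast_mul]⟩

theorem basis_mem {r : ℕ} {b : Module.Basis (Fin r) ℝ V}
    (hb : Submodule.span ℤ (Set.range b) = Λ) (i : Fin r) : b i ∈ Λ :=
  hb ▸ Submodule.subset_span ⟨i, rfl⟩

theorem hasIntegralBasis_prod {r : ℕ} {b : Module.Basis (Fin r) ℝ V}
    (hb : Submodule.span ℤ (Set.range b) = Λ) : HasIntegralBasis (Λ.prod Λ) := by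
  refine ⟨r + r, (b.prod b).reindex finSumFinEquiv, fun i v hv => ?_⟩
  rw [Module.Basis.coord_apply, Module.Basis.repr_reindex_apply]
  rcases finSumFinEquiv.symm i with j | j
  · rw [Module.Basis.prod_repr_inl]
    exact isIntegerValued_coord hb j v.1 hv.1
  · rw [Module.Basis.prod_repr_inr]
    exact isIntegerValued_coord hb j v.2 hv.2

section Intersection

variable {r : ℕ} {b : Module.Basis (Fin r) ℝ V} {U W : Submodule ℝ V}

/-- Write b i = u + w; the pair (u, -w) has difference b i, whose other coordinates vanish. Here U +
W = V ensures that each function really cuts the subspace. -/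
theorem exists_mem_agreeOn_coordDiff_ne_zero (hUW : U ⊔ W = ⊤) {i : Fin r} {l : List (Fin r)}
    (hi : i ∉ l) : ∃ p ∈ agreeOn b (U.prod W) l, coordDiff b i p ≠ 0 := by
  obtain ⟨u, hu, w, hw, e⟩ := Submodule.mem_sup.1 (hUW ▸ Submodule.mem_top : b i ∈ U ⊔ W)
  have hsub : u - -w = b i := by rw [sub_neg_eq_add, e]
  refine ⟨(u, -w), mem_agreeOn.2 ⟨⟨hu, W.neg_mem hw⟩, fun j hj => ?_⟩, ?_⟩
  · have hne : i ≠ j := fun h => hi (h ▸ hj)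
    simp only [hsub]
    simp [hne]
  · rw [coordDiff_apply]
    simp only [hsub]
    simp

/-- Under (u, w) ↦ u - w the lattice of `agreeOn` maps onto the part of Λ_U + Λ_W in `vanishingOn`,
so c generates the i-th coordinates there; on all of `vanishingOn` the value 1 is attained at b i,
as i ∉ l. -/
theorem relIndex_vanishingOn_eq (hb : Submodule.span ℤ (Set.range b) = Λ) {i : Fin r}
    {l : List (Fin r)} (hi : i ∉ l) {c : ℤ}
    (hc : IsGenerator (coordDiff b i) (latticeIn (Λ.prod Λ) (agreeOn b (U.prod W) l)) c) :
    ((latticeIn Λ U ⊔ latticeIn Λ W).toAddSubgroup.relIndex (vanishingOn b Λ l) : ℤ) =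
      c * (latticeIn Λ U ⊔ latticeIn Λ W).toAddSubgroup.relIndex (vanishingOn b Λ (i :: l)) := by
  rw [vanishingOn_cons]
  refine relIndex_eq_mul_relIndex_inf_ker hc.pos
    (fun a ha => isIntegerValued_coord hb i a (mem_vanishingOn.1 ha).1)
    ⟨b i, mem_vanishingOn.2 ⟨basis_mem hb i, fun j hj => ?_⟩, by simp⟩ ?_ ?_
  · have hne : i ≠ j := fun h => hi (h ▸ hj)
    simp [hne]
  · rintro v ⟨hvM, hvN⟩
    obtain ⟨u, hu, w, hw, rfl⟩ := Submodule.mem_sup.1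
      (show v ∈ latticeIn Λ U ⊔ latticeIn Λ W from hvM)
    obtain ⟨n, hn⟩ := hc.exists_eq_mul (u, -w) ⟨⟨hu.1, neg_mem hw.1⟩, mem_agreeOn.2
      ⟨⟨hu.2, W.neg_mem hw.2⟩, fun j hj => by
        simpa using (mem_vanishingOn.1 hvN).2 j hj⟩⟩
    refine ⟨n, ?_⟩
    rw [← hn, coordDiff_apply, sub_neg_eq_add]
  · obtain ⟨p, hp, e⟩ := hc.exists_eq
    obtain ⟨hpL, hpl⟩ := mem_agreeOn.1 hp.2
    refine ⟨p.1 - p.2, ⟨?_, mem_vanishingOn.2 ⟨sub_mem hp.1.1 hp.1.2, hpl⟩⟩, ?_⟩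
    · exact Submodule.sub_mem (latticeIn Λ U ⊔ latticeIn Λ W) (Submodule.mem_sup_left ⟨hp.1.1, hpL.1⟩)
        (Submodule.mem_sup_right ⟨hp.1.2, hpL.2⟩)
    · rw [← coordDiff_apply, e]

/-- The iterated divisor of the functions `max {x i, y i}`, for `i` in a list, on `U × W` is a
subspace whose weight is an index of lattices. -/
theorem foldr_divisor_eq [FiniteDimensional ℝ V] (hb : Submodule.span ℤ (Set.range b) = Λ)
    (hU : IsRationalSubspace Λ U) (hW : IsRationalSubspace Λ W) (hUW : U ⊔ W = ⊤)
    (l : List (Fin r)) (hl : l.Nodup) :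
    ∃ m : ℤ, m ≠ 0 ∧ ∃ hK : IsRationalSubspace (Λ.prod Λ) (agreeOn b (U.prod W) l),
      (l.map fun i (p : V × V) => max (b.coord i p.1) (b.coord i p.2)).foldr divisor
        (cycle (ofSubspace (U.prod W) (hU.prod hW) 1)) = cycle (ofSubspace _ hK m) ∧
      m * (latticeIn Λ U ⊔ latticeIn Λ W).toAddSubgroup.relIndex (vanishingOn b Λ l) =
        latticeIndex Λ (latticeIn Λ U ⊔ latticeIn Λ W) := by
  induction l with
  | nil => exact ⟨1, one_ne_zero, hU.prod hW, rfl, by rw [one_mul]; rfl⟩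
  | cons i l ih =>
    obtain ⟨hi, hl⟩ := List.nodup_cons.1 hl
    obtain ⟨m, hm, hK, e, hidx⟩ := ih hl
    have hx : IsIntegerValued (Λ.prod Λ) (b.coord i ∘ₗ LinearMap.fst ℝ V V) :=
      fun p hp => isIntegerValued_coord hb i p.1 hp.1
    have hy : IsIntegerValued (Λ.prod Λ) (b.coord i ∘ₗ LinearMap.snd ℝ V V) :=
      fun p hp => isIntegerValued_coord hb i p.2 hp.2
    have hg : IsIntegerValued (Λ.prod Λ) (coordDiff b i) := fun p hp => by
      rw [coordDiff_apply]
      exact isIntegerValued_coord hb i _ (sub_mem hp.1 hp.2)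
    -- A repeated coordinate would give the zero form on the subspace reached; `Nodup` excludes
    -- this.
    obtain ⟨c, hc⟩ := IsIntegerValued.exists_isGenerator
      (M := latticeIn (Λ.prod Λ) (agreeOn b (U.prod W) l)) (fun p hp => hg p hp.1)
      (hK.exists_apply_ne_zero (exists_mem_agreeOn_coordDiff_ne_zero hUW hi))
    refine ⟨m * c, mul_ne_zero hm hc.pos.ne', hK.inf_ker hg, ?_, ?_⟩
    · rw [List.map_cons, List.foldr_cons, e]
      exact divisor_cycle_ofSubspace (hasIntegralBasis_prod hb) hK hx hy hc hm (hK.inf_ker hg)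
    -- The weight gains the factor c that the remaining index loses.
    · rw [mul_assoc, ← relIndex_vanishingOn_eq hb hi hc, hidx]

end Intersection

end FanCycle

theorem mainTheorem5 {V : Type*} [AddCommGroup V] [Module ℝ V] [FiniteDimensional ℝ V]
    (Λ : Submodule ℤ V) {r : ℕ} (b : Module.Basis (Fin r) ℝ V)
    (hb : Submodule.span ℤ (Set.range b) = Λ)
    (U W : Submodule ℝ V)
    (hU : FanCycle.IsRationalSubspace Λ U) (hW : FanCycle.IsRationalSubspace Λ W)
    (hUW : U ⊔ W = ⊤) :
    Finite (FanCycle.LatticeQuotient Λ (FanCycle.latticeIn Λ U ⊔ FanCycle.latticeIn Λ W)) ∧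
    ∃ h : FanCycle.IsRationalSubspace Λ (U ⊓ W),
      FanCycle.intersectionProduct (fun i => b.coord i)
          (FanCycle.cycle (FanCycle.ofSubspace U hU 1))
          (FanCycle.cycle (FanCycle.ofSubspace W hW 1)) =
        FanCycle.cycle (FanCycle.ofSubspace (U ⊓ W) h
          (FanCycle.latticeIndex Λ (FanCycle.latticeIn Λ U ⊔ FanCycle.latticeIn Λ W))) := by
  obtain ⟨m, hm, hK, e, hidx⟩ :=
    FanCycle.foldr_divisor_eq hb hU hW hUW (List.finRange r) (List.nodup_finRange r)
  -- With all coordinates used the remaining lattice is 0, so the remaining index is 1 and m is the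
  -- full index.
  have hbot : FanCycle.vanishingOn b Λ (List.finRange r) = ⊥ := by
    refine (AddSubgroup.eq_bot_iff_forall _).2 fun v hv => ?_
    refine b.ext_elem_iff.2 fun i => ?_
    simpa using (FanCycle.mem_vanishingOn.1 hv).2 i (List.mem_finRange i)
  rw [hbot, AddSubgroup.relIndex_bot_right, Nat.cast_one, mul_one] at hidx
  have hmem : ∀ p : V × V, p ∈ FanCycle.agreeOn b (U.prod W) (List.finRange r) ↔
      p.1 ∈ U ∧ p.2 ∈ W ∧ p.1 = p.2 := by
    intro p
    rw [FanCycle.mem_agreeOn, Submodule.mem_prod, and_assoc]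
    refine and_congr_right fun _ => and_congr_right fun _ => ⟨fun h => ?_, fun h i _ => ?_⟩
    · rw [← sub_eq_zero]
      refine b.ext_elem_iff.2 fun i => ?_
      simpa using h i (List.mem_finRange i)
    · rw [h, sub_self, map_zero]
  have hmap : (FanCycle.agreeOn b (U.prod W) (List.finRange r)).map (LinearMap.fst ℝ V V) =
      U ⊓ W := by
    ext v
    constructor
    · rintro ⟨p, hp, rfl⟩
      obtain ⟨h1, h2, h3⟩ := (hmem p).1 hp
      exact ⟨h1, by rw [LinearMap.fst_apply, h3]; exact h2⟩
    · rintro ⟨h1, h2⟩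
      exact ⟨(v, v), (hmem _).2 ⟨h1, h2, rfl⟩, rfl⟩
  have hfst : ∀ p ∈ Λ.prod Λ, LinearMap.fst ℝ V V p ∈ Λ := fun p hp => hp.1
  have h : FanCycle.IsRationalSubspace Λ (U ⊓ W) := hmap ▸ hK.map hfst
  -- An infinite quotient would have index 0 by convention, so m ≠ 0 yields finiteness.
  have hcard : FanCycle.latticeIndex Λ (FanCycle.latticeIn Λ U ⊔ FanCycle.latticeIn Λ W) ≠ 0 := by
    intro h0
    rw [h0] at hidx
    exact hm hidx
  refine ⟨Nat.finite_of_card_ne_zero hcard, h, ?_⟩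
  rw [FanCycle.intersectionProduct, FanCycle.cartesianProduct_cycle_ofSubspace hU hW one_ne_zero
    one_ne_zero, FanCycle.divisors, List.ofFn_eq_map, ← hidx]
  refine (congrArg _ e).trans
    (FanCycle.pushforward_cycle_ofSubspace hfst ?_ hmap ?_ hK h hm)
  · intro p hp q hq hpq
    obtain ⟨-, -, h1⟩ := (hmem p).1 hp
    obtain ⟨-, -, h2⟩ := (hmem q).1 hq
    have hpq : p.1 = q.1 := hpq
    exact Prod.ext hpq (by rw [← h1, ← h2, hpq])
  -- Lattice points of the diagonal of U ∩ W are the pairs (v, v) with v ∈ Λ ∩ U ∩ W, so the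
  -- projection is onto on lattices.
  · ext v
    constructor
    · rintro ⟨p, hp, rfl⟩
      obtain ⟨h1, h2, h3⟩ := (hmem p).1 hp.2
      exact ⟨hp.1.1, h1, by change p.1 ∈ W; rw [h3]; exact h2⟩
    · rintro ⟨h1, h2, h3⟩
      exact ⟨(v, v), ⟨⟨h1, h1⟩, (hmem _).2 ⟨h2, h3, rfl⟩⟩, rfl⟩

end
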